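/- Let $d\ge 1$, and for $n\ge 1$ let $V_n=\mathbb{Z}^d\cap[1,n]^d$. Let $(g_x)_{x\in V_n}$ be independent standard Gaussian random variables (the disorder), and write $\mathbb{E}$ for expectation with respect to them. For $\beta,h>0$ the random field Ising model on $V_n$ with free boundary condition is the random (Gibbs) probability measure on $\{-1,1\}^{V_n}$ that gives $\sigma$ the probability \[ \frac{1}{Z_n(\beta,h)}\exp\Bigl(\beta\sum_{\langle xy\rangle}\sigma_x\sigma_y+h\sum_{x\in V_n}g_x\sigma_x\Bigr), \] where $\langle xy\rangle$ runs over the unordered pairs of nearest neighbors in $V_n$ and $Z_n(\beta,h)$ is the normalizing constant. Let $p(\beta,h)=\lim_{n\to\infty}|V_n|^{-1}\,\mathbb{E}\log Z_n(\beta,h)$ (this limit exists), and let $A$ be the set of all $(\beta,h)\in(0,\infty)^2$ such that $t\mapsto p(\beta,t)$ is not differentiable at $t=h$. Let $k\ge 2$, let $\sigma^1,\dots,\sigma^{k+1}$ be drawn independently from the Gibbs measure given the disorder, let $\langle\cdot\rangle$ denote the average over these replicas, and let $R_{i,j}=|V_n|^{-1}\sum_{x\in V_n}\sigma^i_x\sigma^j_x$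 be the overlaps. Let $f=f\bigl((R_{i,j})_{1\le i,j\le k}\bigr)$ be a function of the overlaps among the first $k$ replicas, with values in $[-1,1]$ and not depending on $n$. Then for every $(\beta,h)\in(0,\infty)^2\setminus A$, \[ \lim_{n\to\infty}\Bigl(\mathbb{E}\langle fR_{1,k+1}\rangle-\frac1k\,\mathbb{E}\langle f\rangle\,\mathbb{E}\langle R_{1,2}\rangle-\frac1k\sum_{i=2}^k\mathbb{E}\langle fR_{1,i}\rangle\Bigr)=0 . \] -/

import Mathlib

namespace RFIM

open MeasureTheory ProbabilityTheory Filter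

/-- The box `V_n = ℤ^d ∩ [1,n]^d`. -/
noncomputable def box (d n : ℕ) : Finset (Fin d → ℤ) :=
  Fintype.piFinset fun _ => Finset.Icc (1 : ℤ) n

/-- Nearest neighbours in `ℤ^d`: the `ℓ¹`-distance is one. -/
abbrev Neighbors {d : ℕ} (x y : Fin d → ℤ) : Prop :=
  ∑ i, |x i - y i| = 1

/-- Spin configurations on `V_n`; the units of `ℤ` are exactly `1` and `-1`. -/
abbrev Config (d n : ℕ) : Type := box d n → ℤˣ

/-- The real number `σ_x ∈ {-1, 1}`. -/
def spin {d n : ℕ} (σ : Config d n) (x : box d n) : ℝ := ((σ x : ℤ) : ℝ)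

/-- A realization of the disorder `(g_x)` on `V_n`. -/
abbrev Disorder (d n : ℕ) : Type := box d n → ℝ

/-- The law of the disorder: independent standard Gaussians. -/
noncomputable def disorderLaw (d n : ℕ) : Measure (Disorder d n) :=
  Measure.pi fun _ => gaussianReal 0 1

/-- The exponent `β ∑_{⟨xy⟩} σ_x σ_y + h ∑_x g_x σ_x`, with free boundary condition. Every
unordered pair of neighbours counts once, whence the factor `1/2` before the sum over ordered
pairs. -/
noncomputable def exponent {d n : ℕ} (β h : ℝ) (g : Disorder d n) (σ : Config d n) : ℝ :=
  β * ((1 / 2 : ℝ) * ∑ x : box d n, ∑ y : box d n,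
      if Neighbors (x : Fin d → ℤ) y then spin σ x * spin σ y else 0)
    + h * ∑ x : box d n, g x * spin σ x

/-- The partition function `Z_n(β,h)`. -/
noncomputable def partitionFunction {d n : ℕ} (β h : ℝ) (g : Disorder d n) : ℝ :=
  ∑ σ : Config d n, Real.exp (exponent β h g σ)

/-- `ψ_n(β,h) = |V_n|⁻¹ log Z_n(β,h)`. -/
noncomputable def freeEnergyDensity {d n : ℕ} (β h : ℝ) (g : Disorder d n) : ℝ :=
  Real.log (partitionFunction β h g) / ((box d n).card : ℝ)

/-- `p_n(β,h) = 𝔼 ψ_n(β,h)`. -/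
noncomputable def meanFreeEnergy (d n : ℕ) (β h : ℝ) : ℝ :=
  ∫ g, freeEnergyDensity β h g ∂(disorderLaw d n)

/-- `p(β,h) = lim_{n → ∞} p_n(β,h)`. -/
noncomputable def limitFreeEnergy (d : ℕ) (β h : ℝ) : ℝ :=
  limUnder atTop fun n : ℕ => meanFreeEnergy d n β h

/-- The set `A` of all `(β,h) ∈ (0,∞)²` at which `p` is not differentiable in `h`. -/
def exceptionalSet (d : ℕ) : Set (ℝ × ℝ) :=
  {q | 0 < q.1 ∧ 0 < q.2 ∧ ¬ DifferentiableAt ℝ (fun t => limitFreeEnergy d q.1 t) q.2}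

/-- The Gibbs probability of the configuration `σ`. -/
noncomputable def gibbsWeight {d n : ℕ} (β h : ℝ) (g : Disorder d n) (σ : Config d n) : ℝ :=
  Real.exp (exponent β h g σ) / partitionFunction β h g

/-- The average `⟨F⟩` over `m` replicas drawn independently from the Gibbs measure. -/
noncomputable def gibbsAvg {d n m : ℕ} (β h : ℝ) (g : Disorder d n)
    (F : (Fin m → Config d n) → ℝ) : ℝ :=
  ∑ s : Fin m → Config d n, (∏ i, gibbsWeight β h g (s i)) * F s

/-- The quenched average `𝔼⟨F⟩` over `m` replicas. -/
noncomputable def quenchedAvg {d n m : ℕ} (β h : ℝ) (F : (Fin m → Config d n) → ℝ) : ℝ :=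
  ∫ g, gibbsAvg β h g F ∂(disorderLaw d n)

/-- The overlap `|V_n|⁻¹ ∑_x σ_x τ_x`. -/
noncomputable def overlap {d n : ℕ} (σ τ : Config d n) : ℝ :=
  (∑ x : box d n, spin σ x * spin τ x) / ((box d n).card : ℝ)

/-- The array `(R_{i,j})` of the overlaps of the first `k` among `k + 1` replicas. -/
noncomputable def overlaps {d n k : ℕ} (s : Fin (k + 1) → Config d n) : Fin k → Fin k → ℝ :=
  fun i j => overlap (s i.castSucc) (s j.castSucc)

end RFIM

/-!
Let `M = |V|⁻¹ ∑ₓ gₓ σ¹ₓ` be the field energy per site of the first replica. By Gaussian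
integration by parts, `𝔼⟨f⟩ 𝔼⟨M⟩ - 𝔼⟨f M⟩` is `h k` times the expression whose limit is asked for,
so it suffices that `M` concentrates under the quenched Gibbs measure: `𝔼⟨|M - p'(h)|⟩ → 0`.

The field enters the exponent linearly, so `log ⟨exp (|V| t (M - q))⟩` is the increment of `log Z`
between `h` and `h + t`, minus its linear prediction `|V| t q`. Since `exp |x| ≤ exp x + exp (-x)`,
Jensen's inequality bounds `t ⟨|M - q|⟩` by the absolute values of these quantities per site, at
`±t`, plus `log 2 / |V|`. For `q = p'(h)` their means are `o(t)` in the limit, by differentiability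
of `p`, and their fluctuations vanish because `log Z` is a Lipschitz function of independent
Gaussians, with variance at most `h² |V|`.

The existence of `p` is a Cauchy estimate: cutting a box of side `m n` into boxes of side `n` only
removes the bonds between blocks, which number at most a constant times `1 / n` of the sites.
-/

namespace RandomField

open MeasureTheory ProbabilityTheory Filter

section ProductMeasures

theorem integral_eq_integral_comp {X Y : Type*} [MeasurableSpace X] [MeasurableSpace Y]
    {μ : Measure X} {ν : Measure Y} {φ : X → Y} (hφ : MeasurePreserving φ μ ν) {F : Y → ℝ}
    (hF : AEStronglyMeasurable F ν) : ∫ y, F y ∂ν = ∫ x, F (φ x) ∂μ := by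
  rw [← hφ.map_eq, integral_map hφ.aemeasurable (hφ.map_eq ▸ hF)]

theorem measurePreserving_pi_comp {V W α : Type*} [Fintype V] [Fintype W] [MeasurableSpace α]
    (μ : Measure α) [IsProbabilityMeasure μ] {e : W → V} (he : Function.Injective e) :
    MeasurePreserving (fun (g : V → α) w => g (e w)) (Measure.pi fun _ => μ)
      (Measure.pi fun _ => μ) := by
  have hind : iIndepFun (fun (v : V) (g : V → α) => g v) (Measure.pi fun _ => μ) :=
    iIndepFun_pi (X := fun _ => id) fun _ => aemeasurable_id
  refine ⟨by fun_prop, ((iIndepFun_iff_map_fun_eq_pi_map fun w =>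
    (measurable_pi_apply (e w)).aemeasurable).1 (hind.precomp he)).trans ?_⟩
  congr 1 with w
  rw [(measurePreserving_eval (fun _ : V => μ) (e w)).map_eq]

theorem measurePreserving_update {V : Type*} [Fintype V] [DecidableEq V] {α : V → Type*}
    [∀ v, MeasurableSpace (α v)] (μ : ∀ v, Measure (α v)) [∀ v, IsProbabilityMeasure (μ v)]
    (x : V) :
    MeasurePreserving (fun p : (∀ v, α v) × α x => Function.update p.1 x p.2)
      ((Measure.pi μ).prod (μ x)) (Measure.pi μ) := by
  have hm : Measurable fun p : (∀ v, α v) × α x => Function.update p.1 x p.2 :=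
    measurable_update'
  refine ⟨hm, (Measure.pi_eq fun s hs => ?_).symm⟩
  have hpre : (fun p : (∀ v, α v) × α x => Function.update p.1 x p.2) ⁻¹' Set.univ.pi s
      = Set.univ.pi (Function.update s x Set.univ) ×ˢ s x := by
    ext p
    simp only [Set.mem_preimage, Set.mem_univ_pi, Set.mem_prod]
    constructor
    · intro h
      refine ⟨fun v => ?_, by simpa using h x⟩
      rcases eq_or_ne v x with rfl | hv
      · simp
      · simpa [hv] using h v
    · rintro ⟨h, hx⟩ v
      rcases eq_or_ne v x with rfl | hv
      · simpa using hx
      · simpa [hv] using h v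
  rw [Measure.map_apply hm (MeasurableSet.univ_pi hs), hpre, Measure.prod_prod, Measure.pi_pi,
    ← Finset.prod_erase_mul _ _ (Finset.mem_univ x),
    ← Finset.prod_erase_mul (a := x) _ (fun v => μ v (s v)) (Finset.mem_univ x)]
  simp only [Function.update_self, measure_univ, mul_one]
  congr 1
  exact Finset.prod_congr rfl fun v hv => by
    rw [Function.update_of_ne (Finset.ne_of_mem_erase hv)]

theorem integral_pi_eq_integral_update {V : Type*} [Fintype V] [DecidableEq V] {α : V → Type*}
    [∀ v, MeasurableSpace (α v)] (μ : ∀ v, Measure (α v)) [∀ v, IsProbabilityMeasure (μ v)]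
    (x : V) {F : (∀ v, α v) → ℝ} (hF : Integrable F (Measure.pi μ)) :
    ∫ g, F g ∂(Measure.pi μ) = ∫ g, ∫ t, F (Function.update g x t) ∂(μ x) ∂(Measure.pi μ) := by
  have hmp := measurePreserving_update μ x
  rw [integral_eq_integral_comp hmp hF.aestronglyMeasurable]
  exact integral_prod _ (hmp.integrable_comp_of_integrable hF)

theorem measurePreserving_finCons {n : ℕ} {α : Fin (n + 1) → Type*} [∀ i, MeasurableSpace (α i)]
    (μ : ∀ i, Measure (α i)) [∀ i, SigmaFinite (μ i)] :
    MeasurePreserving (fun p : α 0 × ∀ i : Fin n, α i.succ => (Fin.cons p.1 p.2 : ∀ i, α i))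
      ((μ 0).prod (Measure.pi fun i : Fin n => μ i.succ)) (Measure.pi μ) := by
  have hcons : (fun p : α 0 × ∀ i : Fin n, α i.succ => (Fin.cons p.1 p.2 : ∀ i, α i))
      = (MeasurableEquiv.piFinSuccAbove α 0).symm := by
    funext p
    exact (Fin.insertNth_zero p.1 p.2).symm
  rw [hcons]
  exact (measurePreserving_piFinSuccAbove μ 0).symm

end ProductMeasures

section Variance

theorem sq_integral_le_integral_sq {Ω : Type*} [MeasurableSpace Ω] {μ : Measure Ω}
    [IsProbabilityMeasure μ] {X : Ω → ℝ} (hX : MemLp X 2 μ) :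
    (∫ ω, X ω ∂μ) ^ 2 ≤ ∫ ω, X ω ^ 2 ∂μ := by
  have h := variance_nonneg X μ
  rw [variance_eq_sub hX] at h
  exact sub_nonneg.1 h

theorem integral_abs_sub_integral_le_sqrt_variance {Ω : Type*} [MeasurableSpace Ω]
    {μ : Measure Ω} [IsProbabilityMeasure μ] {X : Ω → ℝ} (hX : MemLp X 2 μ) :
    ∫ ω, |X ω - ∫ ω', X ω' ∂μ| ∂μ ≤ √(Var[X; μ]) := by
  refine Real.le_sqrt_of_sq_le ?_
  rw [variance_eq_integral hX.aemeasurable]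
  have hdev : MemLp (fun ω => |X ω - ∫ ω', X ω' ∂μ|) 2 μ := (hX.sub (memLp_const _)).abs
  simpa only [sq_abs] using sq_integral_le_integral_sq hdev

variable {X Y : Type*} [MeasurableSpace X] [MeasurableSpace Y] {μ : Measure X} {ν : Measure Y}

theorem ae_memLp_two_prod [SFinite μ] [SFinite ν] {F : X × Y → ℝ} (hF : MemLp F 2 (μ.prod ν)) :
    ∀ᵐ x ∂μ, MemLp (fun y => F (x, y)) 2 ν := by
  filter_upwards [hF.aestronglyMeasurable.prodMk_left, hF.integrable_sq.prod_right_ae]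
    with x hm hi using (memLp_two_iff_integrable_sq hm).2 hi

theorem memLp_two_integral_prod [SFinite μ] [IsProbabilityMeasure ν] {F : X × Y → ℝ}
    (hF : MemLp F 2 (μ.prod ν)) : MemLp (fun x => ∫ y, F (x, y) ∂ν) 2 μ := by
  have hm := hF.aestronglyMeasurable.integral_prod_right'
  refine (memLp_two_iff_integrable_sq hm).2
    (hF.integrable_sq.integral_prod_left.mono' (hm.pow 2) ?_)
  filter_upwards [ae_memLp_two_prod hF] with x hx
  rw [Real.norm_of_nonneg (sq_nonneg _)]
  exact sq_integral_le_integral_sq hx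

theorem variance_prod [IsProbabilityMeasure μ] [IsProbabilityMeasure ν] {F : X × Y → ℝ}
    (hF : MemLp F 2 (μ.prod ν)) :
    Var[F; μ.prod ν]
      = ∫ x, Var[fun y => F (x, y); ν] ∂μ + Var[fun x => ∫ y, F (x, y) ∂ν; μ] := by
  have hG := memLp_two_integral_prod hF
  have hcond : ∫ x, Var[fun y => F (x, y); ν] ∂μ
      = ∫ x, ∫ y, F (x, y) ^ 2 ∂ν ∂μ - ∫ x, (∫ y, F (x, y) ∂ν) ^ 2 ∂μ := by
    rw [← integral_sub hF.integrable_sq.integral_prod_left hG.integrable_sq]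
    refine integral_congr_ae ?_
    filter_upwards [ae_memLp_two_prod hF] with x hx
    simp only [variance_eq_sub hx, Pi.pow_apply]
  rw [hcond, variance_eq_sub hF, variance_eq_sub hG]
  simp only [Pi.pow_apply]
  rw [integral_prod _ (hF.integrable one_le_two), integral_prod _ hF.integrable_sq]
  ring

end Variance

section Lipschitz

variable {V : Type*} [Fintype V] {F : (V → ℝ) → ℝ} {c : V → ℝ}

theorem continuous_of_abs_sub_le_sum (hF : ∀ g g', |F g - F g'| ≤ ∑ x, c x * |g x - g' x|) :
    Continuous F := by
  refine continuous_iff_continuousAt.2 fun g₀ => tendsto_iff_dist_tendsto_zero.2 ?_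
  have h : Continuous fun g : V → ℝ => ∑ x, c x * |g x - g₀ x| := by fun_prop
  exact squeeze_zero (fun _ => dist_nonneg) (fun g => hF g g₀) (by simpa using h.tendsto g₀)

theorem memLp_two_of_abs_sub_le_sum {μ : V → Measure ℝ} [∀ x, IsProbabilityMeasure (μ x)]
    (hμ : ∀ x, MemLp id 2 (μ x)) (hF : ∀ g g', |F g - F g'| ≤ ∑ x, c x * |g x - g' x|) :
    MemLp F 2 (Measure.pi μ) := by
  have hx : ∀ x, MemLp (fun g : V → ℝ => g x) 2 (Measure.pi μ) := fun x =>
    (hμ x).comp_measurePreserving (measurePreserving_eval μ x)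
  have hdom : MemLp (fun g : V → ℝ => |F 0| + ∑ x, c x * |g x|) 2 (Measure.pi μ) :=
    (memLp_const |F 0|).add (memLp_finsetSum _ fun x _ => (hx x).abs.const_mul (c x))
  refine hdom.mono (continuous_of_abs_sub_le_sum hF).aestronglyMeasurable (ae_of_all _ fun g => ?_)
  have h0 : |F g - F 0| ≤ ∑ x, c x * |g x| := by simpa using hF g 0
  rw [Real.norm_eq_abs, Real.norm_eq_abs]
  exact le_trans (by linarith [abs_sub_abs_le_abs_sub (F g) (F 0)]) (le_abs_self _)

theorem variance_le_of_abs_sub_le {μ : Measure ℝ} [IsProbabilityMeasure μ] (hμ : MemLp id 2 μ)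
    {G : ℝ → ℝ} {c : ℝ} (hG : ∀ s t, |G s - G t| ≤ c * |s - t|) :
    Var[G; μ] ≤ c ^ 2 * Var[id; μ] := by
  have hGm : AEStronglyMeasurable G μ :=
    (LipschitzWith.of_dist_le' (f := G) (K := c) hG).continuous.aestronglyMeasurable
  set m := ∫ t, id t ∂μ
  have hpoint : ∀ t, (G t - G m) ^ 2 ≤ c ^ 2 * (t - m) ^ 2 := fun t => by
    rw [← sq_abs (G t - G m), ← sq_abs (t - m), ← mul_pow]
    exact pow_le_pow_left₀ (abs_nonneg _) (hG t m) 2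
  calc Var[G; μ] = Var[fun t => G t - G m; μ] := (variance_sub_const hGm _).symm
    _ ≤ ∫ t, (G t - G m) ^ 2 ∂μ := variance_le_expectation_sq (hGm.sub aestronglyMeasurable_const)
    _ ≤ ∫ t, c ^ 2 * (t - m) ^ 2 ∂μ :=
        integral_mono_of_nonneg (ae_of_all _ fun _ => sq_nonneg _)
          ((hμ.sub (memLp_const m)).integrable_sq.const_mul _) (ae_of_all _ hpoint)
    _ = c ^ 2 * Var[id; μ] := by
        rw [integral_const_mul, variance_eq_integral aemeasurable_id]
        rfl

theorem variance_pi_fin_le {n : ℕ} {F : (Fin n → ℝ) → ℝ} {c : Fin n → ℝ}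
    {μ : Fin n → Measure ℝ} [∀ i, IsProbabilityMeasure (μ i)] (hμ : ∀ i, MemLp id 2 (μ i))
    (hF : ∀ g g', |F g - F g'| ≤ ∑ i, c i * |g i - g' i|) :
    Var[F; Measure.pi μ] ≤ ∑ i, c i ^ 2 * Var[id; μ i] := by
  induction n with
  | zero =>
    have hconst : F = fun _ => F 0 := funext fun g => congrArg F (Subsingleton.elim _ _)
    rw [hconst, variance_eq_sub (memLp_const _)]
    simp
  | succ n ih =>
    have hcons := measurePreserving_finCons μ
    have hF2 : MemLp F 2 (Measure.pi μ) := memLp_two_of_abs_sub_le_sum hμ hF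
    have hF2' : MemLp (fun p : ℝ × (Fin n → ℝ) => F (Fin.cons p.1 p.2)) 2 _ :=
      hF2.comp_measurePreserving hcons
    have hFlip : ∀ s t (g g' : Fin n → ℝ), |F (Fin.cons s g) - F (Fin.cons t g')|
        ≤ c 0 * |s - t| + ∑ i, c i.succ * |g i - g' i| := fun s t g g' => by
      simpa [Fin.sum_univ_succ] using hF (Fin.cons s g) (Fin.cons t g')
    have htail : ∀ t (g g' : Fin n → ℝ), |F (Fin.cons t g) - F (Fin.cons t g')|
        ≤ ∑ i, c i.succ * |g i - g' i| := fun t g g' => by simpa using hFlip t t g g'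
    have hint : ∀ t, Integrable (fun g => F (Fin.cons t g))
        (Measure.pi fun i : Fin n => μ i.succ) := fun t =>
      (memLp_two_of_abs_sub_le_sum (fun i => hμ i.succ) (htail t)).integrable one_le_two
    have hhead : ∀ s t, |∫ g, F (Fin.cons s g) ∂(Measure.pi fun i : Fin n => μ i.succ)
        - ∫ g, F (Fin.cons t g) ∂(Measure.pi fun i : Fin n => μ i.succ)| ≤ c 0 * |s - t| := by
      intro s t
      have hst : ∀ g : Fin n → ℝ, ‖F (Fin.cons s g) - F (Fin.cons t g)‖ ≤ c 0 * |s - t| :=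
        fun g => by simpa using hFlip s t g g
      rw [← integral_sub (hint s) (hint t)]
      simpa using norm_integral_le_of_norm_le_const
        (μ := Measure.pi fun i : Fin n => μ i.succ) (ae_of_all _ hst)
    have htotal : ∫ t, Var[fun g => F (Fin.cons t g); Measure.pi fun i : Fin n => μ i.succ] ∂(μ 0)
        ≤ ∑ i : Fin n, c i.succ ^ 2 * Var[id; μ i.succ] := by
      refine (integral_mono_of_nonneg (ae_of_all _ fun _ => variance_nonneg _ _)
        (integrable_const _) (ae_of_all _ fun t => ih (fun i => hμ i.succ) (htail t))).trans_eq ?_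
      simp
    rw [← hcons.variance_fun_comp hF2.aemeasurable, variance_prod hF2', Fin.sum_univ_succ, add_comm]
    exact add_le_add (variance_le_of_abs_sub_le (hμ 0) hhead) htotal

theorem variance_pi_le {μ : V → Measure ℝ} [∀ x, IsProbabilityMeasure (μ x)]
    (hμ : ∀ x, MemLp id 2 (μ x)) (hF : ∀ g g', |F g - F g'| ≤ ∑ x, c x * |g x - g' x|) :
    Var[F; Measure.pi μ] ≤ ∑ x, c x ^ 2 * Var[id; μ x] := by
  let e := (Fintype.equivFin V).symm
  have hmp := measurePreserving_piCongrLeft μ e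
  have he : ∀ g i, MeasurableEquiv.piCongrLeft (fun _ : V => ℝ) e g (e i) = g i := fun g i =>
    Equiv.piCongrLeft_apply_apply (fun _ : V => ℝ) e g i
  rw [← hmp.variance_fun_comp (continuous_of_abs_sub_le_sum hF).aemeasurable, ← e.sum_comp]
  refine variance_pi_fin_le (fun i => hμ (e i)) fun g g' => (hF _ _).trans_eq ?_
  rw [← e.sum_comp]
  simp only [he]

end Lipschitz

section Gaussian

/-- The law of a family of independent standard Gaussians indexed by `V`. -/
noncomputable abbrev stdGaussianPi (V : Type*) [Fintype V] : Measure (V → ℝ) :=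
  Measure.pi fun _ => gaussianReal 0 1

theorem memLp_two_id_stdGaussian : MemLp id 2 (gaussianReal 0 1) :=
  memLp_id_gaussianReal' 2 (by simp)

theorem hasDerivAt_gaussianPDFReal_zero_one (t : ℝ) :
    HasDerivAt (gaussianPDFReal 0 1) (-t * gaussianPDFReal 0 1 t) t := by
  have hpdf : gaussianPDFReal 0 1 = fun t => (√(2 * Real.pi))⁻¹ * Real.exp (-t ^ 2 / 2) := by
    funext t
    simp [gaussianPDFReal]
  have hexponent : HasDerivAt (fun t : ℝ => -t ^ 2 / 2) (-t) t := by
    convert! ((hasDerivAt_id t).pow 2).neg.div_const 2 using 1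
    simp [neg_div]
  rw [hpdf]
  convert! hexponent.exp.const_mul (√(2 * Real.pi))⁻¹ using 1
  ring

theorem integral_id_mul_stdGaussian {F F' : ℝ → ℝ} {C C' : ℝ}
    (hF : ∀ t, HasDerivAt F (F' t) t) (hC : ∀ t, |F t| ≤ C) (hC' : ∀ t, |F' t| ≤ C') :
    ∫ t, t * F t ∂(gaussianReal 0 1) = ∫ t, F' t ∂(gaussianReal 0 1) := by
  have hFm : AEStronglyMeasurable F volume :=
    (continuous_iff_continuousAt.2 fun t => (hF t).continuousAt).aestronglyMeasurable
  have hF'm : AEStronglyMeasurable F' volume := by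
    rw [show F' = deriv F from funext fun t => (hF t).deriv.symm]
    exact (measurable_deriv F).aestronglyMeasurable
  set φ := gaussianPDFReal 0 1
  have hφ : Integrable φ := integrable_gaussianPDFReal 0 1
  have hidφ : Integrable fun t => t * φ t := by
    have h := memLp_two_id_stdGaussian.integrable one_le_two
    rw [gaussianReal_of_var_ne_zero 0 one_ne_zero, integrable_withDensity_iff
      (measurable_gaussianPDF 0 1) (ae_of_all _ fun _ => gaussianPDF_lt_top)] at h
    simpa only [toReal_gaussianPDF, id_eq] using h
  have hF'φ : Integrable fun t => F' t * φ t := hφ.bdd_mul hF'm (ae_of_all _ hC')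
  have hFidφ : Integrable fun t => F t * (t * φ t) := hidφ.bdd_mul hFm (ae_of_all _ hC)
  have hzero : ∫ t, (F' t * φ t - F t * (t * φ t)) = 0 :=
    integral_eq_zero_of_hasDerivAt_of_integrable (f := fun t => F t * φ t)
      (fun t => by
        convert! (hF t).mul (hasDerivAt_gaussianPDFReal_zero_one t) using 1
        ring)
      (hF'φ.sub hFidφ) (hφ.bdd_mul hFm (ae_of_all _ hC))
  rw [integral_sub hF'φ hFidφ, sub_eq_zero] at hzero
  simp only [integral_gaussianReal_eq_integral_smul one_ne_zero, smul_eq_mul]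
  calc ∫ t, φ t * (t * F t) = ∫ t, F t * (t * φ t) := by congr 1 with t; ring
    _ = ∫ t, F' t * φ t := hzero.symm
    _ = ∫ t, φ t * F' t := by simp only [mul_comm]

variable {V : Type*} [Fintype V]

theorem integrable_eval_stdGaussianPi (x : V) :
    Integrable (fun g : V → ℝ => g x) (stdGaussianPi V) :=
  (memLp_two_id_stdGaussian.comp_measurePreserving
    (measurePreserving_eval (fun _ => gaussianReal 0 1) x)).integrable one_le_two

theorem integral_eval_mul_stdGaussianPi [DecidableEq V] (x : V) {F F' : (V → ℝ) → ℝ} {C C' : ℝ}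
    (hFc : Continuous F) (hFc' : Continuous F')
    (hF : ∀ g t, HasDerivAt (fun t => F (Function.update g x t)) (F' (Function.update g x t)) t)
    (hC : ∀ g, |F g| ≤ C) (hC' : ∀ g, |F' g| ≤ C') :
    ∫ g, g x * F g ∂(stdGaussianPi V) = ∫ g, F' g ∂(stdGaussianPi V) := by
  have hint : Integrable (fun g : V → ℝ => g x * F g) (stdGaussianPi V) :=
    (integrable_eval_stdGaussianPi x).mul_bdd hFc.aestronglyMeasurable (ae_of_all _ hC)
  have hint' : Integrable F' (stdGaussianPi V) :=
    Integrable.of_bound hFc'.aestronglyMeasurable C' (ae_of_all _ hC')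
  rw [integral_pi_eq_integral_update _ x hint, integral_pi_eq_integral_update _ x hint']
  simp only [Function.update_self]
  congr 1 with g
  exact integral_id_mul_stdGaussian (hF g) (fun _ => hC _) fun _ => hC' _

end Gaussian

section Gibbs

variable {S : Type*} [Fintype S]

/-- The log-partition function `log ∑ₛ exp (E s)` of the finite system with exponent `E`. -/
noncomputable def logPartition (E : S → ℝ) : ℝ :=
  Real.log (∑ s, Real.exp (E s))

/-- The Gibbs probability of the state `s`, proportional to `exp (E s)`. -/
noncomputable def gibbs (E : S → ℝ) (s : S) : ℝ :=
  Real.exp (E s) / ∑ s, Real.exp (E s)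

theorem logPartition_add_const [Nonempty S] (E : S → ℝ) (c : ℝ) :
    logPartition (fun s => E s + c) = logPartition E + c := by
  have hpos : 0 < ∑ s, Real.exp (E s) :=
    Finset.sum_pos (fun _ _ => Real.exp_pos _) Finset.univ_nonempty
  simp only [logPartition, Real.exp_add, ← Finset.sum_mul]
  rw [Real.log_mul hpos.ne' (Real.exp_ne_zero c), Real.log_exp]

theorem logPartition_mono [Nonempty S] {E E' : S → ℝ} (h : ∀ s, E s ≤ E' s) :
    logPartition E ≤ logPartition E' :=
  Real.log_le_log (Finset.sum_pos (fun _ _ => Real.exp_pos _) Finset.univ_nonempty)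
    (Finset.sum_le_sum fun s _ => Real.exp_le_exp.2 (h s))

theorem abs_logPartition_sub_le [Nonempty S] {E E' : S → ℝ} {c : ℝ}
    (h : ∀ s, |E s - E' s| ≤ c) : |logPartition E - logPartition E'| ≤ c := by
  have hle : logPartition E ≤ logPartition E' + c := by
    rw [← logPartition_add_const]
    exact logPartition_mono fun s => by linarith [(abs_le.1 (h s)).2]
  have hge : logPartition E' ≤ logPartition E + c := by
    rw [← logPartition_add_const]
    exact logPartition_mono fun s => by linarith [(abs_le.1 (h s)).1]
  rw [abs_le]
  constructor <;> linarith

theorem gibbs_eq_exp_sub_logPartition [Nonempty S] (E : S → ℝ) (s : S) :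
    gibbs E s = Real.exp (E s - logPartition E) := by
  rw [Real.exp_sub, logPartition, Real.exp_log]
  · rfl
  · exact Finset.sum_pos (fun _ _ => Real.exp_pos _) Finset.univ_nonempty

theorem gibbs_mem_stdSimplex [Nonempty S] (E : S → ℝ) : gibbs E ∈ stdSimplex ℝ S := by
  refine ⟨fun s => ?_, ?_⟩
  · rw [gibbs_eq_exp_sub_logPartition]
    exact (Real.exp_pos _).le
  · unfold gibbs
    rw [← Finset.sum_div]
    exact div_self (Finset.sum_pos (fun _ _ => Real.exp_pos _) Finset.univ_nonempty).ne'

theorem logPartition_comp_equiv {S' : Type*} [Fintype S'] (φ : S' ≃ S) (E : S → ℝ) :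
    logPartition (fun s => E (φ s)) = logPartition E := by
  unfold logPartition
  rw [φ.sum_comp fun s => Real.exp (E s)]

theorem logPartition_sum_pi {A : Type*} [Fintype A] [DecidableEq A] [Nonempty S] (E : A → S → ℝ) :
    logPartition (fun s : A → S => ∑ a, E a (s a)) = ∑ a, logPartition (E a) := by
  have hpos : ∀ a, 0 < ∑ s, Real.exp (E a s) := fun a =>
    Finset.sum_pos (fun _ _ => Real.exp_pos _) Finset.univ_nonempty
  unfold logPartition
  rw [← Real.log_prod fun a _ => (hpos a).ne', Finset.prod_univ_sum, Fintype.piFinset_univ]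
  simp only [Real.exp_sum]

theorem continuous_gibbs {X : Type*} [TopologicalSpace X] [Nonempty S] {E : X → S → ℝ}
    (hE : ∀ s, Continuous fun x => E x s) (s : S) : Continuous fun x => gibbs (E x) s :=
  (hE s).rexp.div (continuous_finsetSum _ fun s _ => (hE s).rexp) fun _ =>
    (Finset.sum_pos (fun _ _ => Real.exp_pos _) Finset.univ_nonempty).ne'

theorem hasDerivAt_logPartition [Nonempty S] {E : ℝ → S → ℝ} {E' : S → ℝ} {t : ℝ}
    (hE : ∀ s, HasDerivAt (fun t => E t s) (E' s) t) :
    HasDerivAt (fun t => logPartition (E t)) (∑ s, gibbs (E t) s * E' s) t := by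
  have hpos : 0 < ∑ s, Real.exp (E t s) :=
    Finset.sum_pos (fun _ _ => Real.exp_pos _) Finset.univ_nonempty
  convert! (HasDerivAt.fun_sum fun s _ => (hE s).exp).log hpos.ne' using 1
  rw [Finset.sum_div]
  exact Finset.sum_congr rfl fun s _ => div_mul_eq_mul_div _ _ _

theorem log_sum_gibbs_mul_exp [Nonempty S] (E X : S → ℝ) :
    Real.log (∑ s, gibbs E s * Real.exp (X s))
      = logPartition (fun s => E s + X s) - logPartition E := by
  have hterm : ∀ s, gibbs E s * Real.exp (X s)
      = Real.exp (E s + X s + -logPartition E) := fun s => by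
    rw [gibbs_eq_exp_sub_logPartition, ← Real.exp_add]
    ring_nf
  simp only [hterm, sub_eq_add_neg]
  exact logPartition_add_const (fun s => E s + X s) _

theorem sum_gibbs_mul_abs_le [Nonempty S] (E X : S → ℝ) :
    ∑ s, gibbs E s * |X s| ≤ Real.log 2
      + (|logPartition (fun s => E s + X s) - logPartition E|
        + |logPartition (fun s => E s + -X s) - logPartition E|) := by
  obtain ⟨hnonneg, hsum⟩ := gibbs_mem_stdSimplex E
  set a := ∑ s, gibbs E s * Real.exp (X s) with ha
  set b := ∑ s, gibbs E s * Real.exp (-X s) with hb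
  have hpos : ∀ Y : S → ℝ, 0 < ∑ s, gibbs E s * Real.exp (Y s) := fun Y =>
    Finset.sum_pos (fun s _ => by
      rw [gibbs_eq_exp_sub_logPartition]
      positivity) Finset.univ_nonempty
  have hjensen : Real.exp (∑ s, gibbs E s * |X s|) ≤ ∑ s, gibbs E s * Real.exp |X s| :=
    convexOn_exp.map_sum_le (fun s _ => hnonneg s) hsum fun _ _ => Set.mem_univ _
  have hsplit : ∑ s, gibbs E s * Real.exp |X s| ≤ a + b := by
    rw [ha, hb, ← Finset.sum_add_distrib]
    refine Finset.sum_le_sum fun s _ => ?_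
    rw [← mul_add]
    exact mul_le_mul_of_nonneg_left (Real.exp_abs_le (X s)) (hnonneg s)
  have hle : ∀ Y : S → ℝ, ∑ s, gibbs E s * Real.exp (Y s)
      ≤ Real.exp |logPartition (fun s => E s + Y s) - logPartition E| := fun Y => by
    rw [← log_sum_gibbs_mul_exp]
    exact (Real.exp_log (hpos Y)).symm.trans_le (Real.exp_le_exp.2 (le_abs_self _))
  set A := |logPartition (fun s => E s + X s) - logPartition E|
  set B := |logPartition (fun s => E s + -X s) - logPartition E|
  rw [← Real.exp_le_exp, Real.exp_add, Real.exp_log two_pos]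
  have hA : Real.exp A ≤ Real.exp (A + B) :=
    Real.exp_le_exp.2 (le_add_of_nonneg_right (abs_nonneg _))
  have hB : Real.exp B ≤ Real.exp (A + B) :=
    Real.exp_le_exp.2 (le_add_of_nonneg_left (abs_nonneg _))
  linarith [hle X, hle fun s => -X s]

end Gibbs

section Replicas

variable {S ι κ : Type*} [Fintype S] [Fintype ι] [DecidableEq ι] [Fintype κ] [DecidableEq κ]

/-- The average of `F` over replicas indexed by `ι`, drawn independently with weights `w`. -/
def replicaAvg (w : S → ℝ) (F : (ι → S) → ℝ) : ℝ :=
  ∑ s : ι → S, (∏ i, w (s i)) * F s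

variable {w : S → ℝ}

theorem replicaAvg_sub (F G : (ι → S) → ℝ) :
    replicaAvg w (fun s => F s - G s) = replicaAvg w F - replicaAvg w G := by
  simp only [replicaAvg, mul_sub, Finset.sum_sub_distrib]

theorem replicaAvg_const_mul (c : ℝ) (F : (ι → S) → ℝ) :
    replicaAvg w (fun s => c * F s) = c * replicaAvg w F := by
  simp only [replicaAvg, mul_left_comm _ c, Finset.mul_sum]

theorem replicaAvg_sum {α : Type*} (t : Finset α) (F : α → (ι → S) → ℝ) :
    replicaAvg w (fun s => ∑ a ∈ t, F a s) = ∑ a ∈ t, replicaAvg w (F a) := by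
  simp only [replicaAvg, Finset.mul_sum]
  exact Finset.sum_comm

theorem replicaAvg_comp_injective (hw : ∑ σ, w σ = 1) {e : κ → ι} (he : Function.Injective e)
    (F : (κ → S) → ℝ) :
    replicaAvg w (fun s : ι → S => F fun j => s (e j)) = replicaAvg w F := by
  classical
  let φ : κ ⊕ ↥(Set.range e)ᶜ ≃ ι :=
    ((Equiv.ofInjective e he).sumCongr (Equiv.refl _)).trans (Equiv.Set.sumCompl (Set.range e))
  have hφ : ∀ j, φ (Sum.inl j) = e j := fun j => by simp [φ]
  have hone : ∑ v : ↥(Set.range e)ᶜ → S, ∏ i, w (v i) = 1 := by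
    rw [← Fintype.piFinset_univ, ← Finset.prod_univ_sum]
    simp [hw]
  unfold replicaAvg
  rw [← (φ.arrowCongr (Equiv.refl S)).sum_comp,
    ← (Equiv.sumArrowEquivProdArrow κ ↥(Set.range e)ᶜ S).symm.sum_comp, Fintype.sum_prod_type]
  refine Finset.sum_congr rfl fun u _ => ?_
  simp only [← φ.prod_comp, Fintype.prod_sum_type, ← hφ, Equiv.arrowCongr_apply,
    Function.comp_apply, Equiv.symm_apply_apply, Equiv.refl_apply,
    Equiv.sumArrowEquivProdArrow_symm_apply_inl,
    Equiv.sumArrowEquivProdArrow_symm_apply_inr]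
  rw [← Finset.sum_mul, ← Finset.mul_sum, hone, mul_one]

theorem replicaAvg_single (hw : ∑ σ, w σ = 1) (i : ι) (φ : S → ℝ) :
    replicaAvg w (fun s : ι → S => φ (s i)) = ∑ σ, w σ * φ σ := by
  rw [replicaAvg_comp_injective hw (e := fun _ : Unit => i) (Function.injective_of_subsingleton _)
    fun u => φ (u ()), replicaAvg, ← (Equiv.funUnique Unit S).symm.sum_comp]
  simp

theorem replicaAvg_const (hw : ∑ σ, w σ = 1) (c : ℝ) :
    replicaAvg w (fun _ : ι → S => c) = c := by
  have h := replicaAvg_comp_injective (w := w) hw (e := (Empty.elim : Empty → ι))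
    (Function.injective_of_subsingleton _) fun _ => c
  simpa [replicaAvg] using h

theorem abs_replicaAvg_le_replicaAvg (hw : ∀ σ, 0 ≤ w σ) {F G : (ι → S) → ℝ}
    (hFG : ∀ s, |F s| ≤ G s) : |replicaAvg w F| ≤ replicaAvg w G := by
  refine (Finset.abs_sum_le_sum_abs _ _).trans (Finset.sum_le_sum fun s _ => ?_)
  have hpos : 0 ≤ ∏ i, w (s i) := Finset.prod_nonneg fun i _ => hw (s i)
  rw [abs_mul, abs_of_nonneg hpos]
  exact mul_le_mul_of_nonneg_left (hFG s) hpos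

theorem abs_replicaAvg_le (hw : w ∈ stdSimplex ℝ S) {F : (ι → S) → ℝ} {C : ℝ}
    (hF : ∀ s, |F s| ≤ C) : |replicaAvg w F| ≤ C :=
  (abs_replicaAvg_le_replicaAvg hw.1 hF).trans_eq (replicaAvg_const hw.2 C)

theorem replicaAvg_init (hw : ∑ σ, w σ = 1) {m : ℕ} (F : (Fin m → S) → ℝ) :
    replicaAvg w (fun s : Fin (m + 1) → S => F fun i => s i.castSucc) = replicaAvg w F :=
  replicaAvg_comp_injective hw (Fin.castSucc_injective m) F

theorem replicaAvg_init_mul_last {m : ℕ} (F : (Fin m → S) → ℝ) (φ : S → ℝ) :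
    replicaAvg w (fun s : Fin (m + 1) → S => F (fun i => s i.castSucc) * φ (s (Fin.last m)))
      = replicaAvg w F * ∑ σ, w σ * φ σ := by
  unfold replicaAvg
  rw [← (Fin.snocEquiv fun _ => S).sum_comp, Fintype.sum_prod_type_right, Finset.sum_mul_sum]
  refine Finset.sum_congr rfl fun s _ => Finset.sum_congr rfl fun σ _ => ?_
  simp only [Fin.snocEquiv_apply, Fin.prod_univ_castSucc, Fin.snoc_castSucc, Fin.snoc_last]
  ring

theorem continuous_replicaAvg_gibbs {X : Type*} [TopologicalSpace X] [Nonempty S] {E : X → S → ℝ}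
    (hE : ∀ s, Continuous fun x => E x s) (F : (ι → S) → ℝ) :
    Continuous fun x => replicaAvg (gibbs (E x)) F :=
  continuous_finsetSum _ fun s _ =>
    (continuous_finsetProd _ fun i _ => continuous_gibbs hE (s i)).mul continuous_const

theorem hasDerivAt_replicaAvg_gibbs [Nonempty S] {m : ℕ} (F : (Fin m → S) → ℝ) {E : ℝ → S → ℝ}
    {E' : S → ℝ} {t : ℝ} (hE : ∀ σ, HasDerivAt (fun t => E t σ) (E' σ) t) :
    HasDerivAt (fun t => replicaAvg (gibbs (E t)) F)
      (replicaAvg (gibbs (E t)) fun s : Fin (m + 1) → S => F (fun i => s i.castSucc)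
        * (∑ i : Fin m, E' (s i.castSucc) - m * E' (s (Fin.last m)))) t := by
  have hprod : ∀ t (s : Fin m → S), ∏ i, gibbs (E t) (s i)
      = Real.exp (∑ i, E t (s i) - m * logPartition (E t)) := fun t s => by
    simp [gibbs_eq_exp_sub_logPartition, ← Real.exp_sum]
  have hterm : ∀ s : Fin m → S, HasDerivAt (fun t => (∏ i, gibbs (E t) (s i)) * F s)
      ((∏ i, gibbs (E t) (s i))
        * (F s * ∑ i, E' (s i) - m * (F s * ∑ σ, gibbs (E t) σ * E' σ))) t := fun s => by
    simp only [hprod]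
    convert! (((HasDerivAt.fun_sum fun i _ => hE (s i)).fun_sub
      ((hasDerivAt_logPartition hE).const_mul (m : ℝ))).exp).mul_const (F s) using 1
    ring
  have hw := (gibbs_mem_stdSimplex (E t)).2
  have hvalue : replicaAvg (gibbs (E t)) (fun s : Fin (m + 1) → S => F (fun i => s i.castSucc)
        * (∑ i : Fin m, E' (s i.castSucc) - m * E' (s (Fin.last m))))
      = replicaAvg (gibbs (E t))
        fun s => F s * ∑ i, E' (s i) - m * (F s * ∑ σ, gibbs (E t) σ * E' σ) := by
    simp only [mul_sub, mul_left_comm _ (m : ℝ), mul_comm (F _) (∑ σ, gibbs (E t) σ * E' σ)]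
    rw [replicaAvg_sub, replicaAvg_sub, replicaAvg_const_mul, replicaAvg_const_mul,
      replicaAvg_const_mul, replicaAvg_init_mul_last F E',
      replicaAvg_init hw fun s => F s * ∑ i, E' (s i), mul_comm (replicaAvg _ F)]
  rw [hvalue]
  exact HasDerivAt.fun_sum fun s _ => hterm s

end Replicas

theorem abs_unit_cast (u : ℤˣ) : |((u : ℤ) : ℝ)| = 1 := by
  rcases Int.units_eq_one_or u with hu | hu <;> simp [hu]

section FreeEnergy

variable {V : Type*} [Fintype V]

/-- The exponent `H(σ) + h ∑ₓ gₓ σₓ` of an Ising system on `V` with interaction `H` in the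
field `h g`. -/
noncomputable def fieldEnergy (H : (V → ℤˣ) → ℝ) (h : ℝ) (g : V → ℝ) (σ : V → ℤˣ) : ℝ :=
  H σ + h * ∑ x, g x * ((σ x : ℤ) : ℝ)

theorem abs_fieldEnergy_sub_le (H : (V → ℤˣ) → ℝ) (h : ℝ) (g g' : V → ℝ) (σ : V → ℤˣ) :
    |fieldEnergy H h g σ - fieldEnergy H h g' σ| ≤ ∑ x, |h| * |g x - g' x| := by
  have hdiff : fieldEnergy H h g σ - fieldEnergy H h g' σ
      = ∑ x, h * (g x - g' x) * ((σ x : ℤ) : ℝ) := by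
    simp only [fieldEnergy, mul_assoc, ← Finset.mul_sum, sub_mul, Finset.sum_sub_distrib]
    ring
  rw [hdiff]
  refine (Finset.abs_sum_le_sum_abs _ _).trans_eq (Finset.sum_congr rfl fun x _ => ?_)
  rw [abs_mul, abs_mul, abs_unit_cast, mul_one]

theorem continuous_fieldEnergy (H : (V → ℤˣ) → ℝ) (h : ℝ) (σ : V → ℤˣ) :
    Continuous fun g : V → ℝ => fieldEnergy H h g σ := by
  unfold fieldEnergy
  fun_prop

variable [DecidableEq V]

/-- The mean `𝔼 log Z` of the log-partition function over the Gaussian field. -/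
noncomputable def meanLogPartition (H : (V → ℤˣ) → ℝ) (h : ℝ) : ℝ :=
  ∫ g, logPartition (fieldEnergy H h g) ∂(stdGaussianPi V)

theorem abs_logPartition_fieldEnergy_sub_le (H : (V → ℤˣ) → ℝ) (h : ℝ) (g g' : V → ℝ) :
    |logPartition (fieldEnergy H h g) - logPartition (fieldEnergy H h g')|
      ≤ ∑ x, |h| * |g x - g' x| :=
  abs_logPartition_sub_le (abs_fieldEnergy_sub_le H h g g')

theorem memLp_two_logPartition_fieldEnergy (H : (V → ℤˣ) → ℝ) (h : ℝ) :
    MemLp (fun g => logPartition (fieldEnergy H h g)) 2 (stdGaussianPi V) :=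
  memLp_two_of_abs_sub_le_sum (fun _ => memLp_two_id_stdGaussian)
    (abs_logPartition_fieldEnergy_sub_le H h)

theorem integrable_logPartition_fieldEnergy (H : (V → ℤˣ) → ℝ) (h : ℝ) :
    Integrable (fun g => logPartition (fieldEnergy H h g)) (stdGaussianPi V) :=
  (memLp_two_logPartition_fieldEnergy H h).integrable one_le_two

theorem integral_abs_logPartition_sub_mean_le (H : (V → ℤˣ) → ℝ) (h : ℝ) :
    ∫ g, |logPartition (fieldEnergy H h g) - meanLogPartition H h| ∂(stdGaussianPi V)
      ≤ |h| * √(Fintype.card V) := by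
  have hvar := variance_pi_le (fun _ : V => memLp_two_id_stdGaussian)
    (abs_logPartition_fieldEnergy_sub_le H h)
  simp only [variance_id_gaussianReal, NNReal.coe_one, mul_one, sq_abs, Finset.sum_const,
    Finset.card_univ, nsmul_eq_mul] at hvar
  refine (integral_abs_sub_integral_le_sqrt_variance
    (memLp_two_logPartition_fieldEnergy H h)).trans ((Real.sqrt_le_sqrt hvar).trans_eq ?_)
  rw [Real.sqrt_mul (Nat.cast_nonneg _), Real.sqrt_sq_eq_abs, mul_comm]

theorem abs_meanLogPartition_sub_le {H H' : (V → ℤˣ) → ℝ} {c : ℝ} (hc : ∀ σ, |H σ - H' σ| ≤ c)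
    (h : ℝ) : |meanLogPartition H h - meanLogPartition H' h| ≤ c := by
  unfold meanLogPartition
  rw [← integral_sub (integrable_logPartition_fieldEnergy H h)
    (integrable_logPartition_fieldEnergy H' h)]
  have hlog : ∀ g : V → ℝ,
      ‖logPartition (fieldEnergy H h g) - logPartition (fieldEnergy H' h g)‖ ≤ c := fun g =>
    abs_logPartition_sub_le fun σ => by simpa [fieldEnergy] using hc σ
  simpa using norm_integral_le_of_norm_le_const (μ := stdGaussianPi V) (ae_of_all _ hlog)

theorem logPartition_fieldEnergy_blocks {A B : Type*} [Fintype A] [Fintype B]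
    [DecidableEq B] (e : A × B ≃ V) (H : (B → ℤˣ) → ℝ) (h : ℝ) (g : V → ℝ) :
    logPartition (fieldEnergy (fun σ : V → ℤˣ => ∑ a, H fun b => σ (e (a, b))) h g)
      = ∑ a, logPartition (fieldEnergy H h fun b => g (e (a, b))) := by
  classical
  let φ : (V → ℤˣ) ≃ (A → B → ℤˣ) :=
    (e.symm.arrowCongr (Equiv.refl ℤˣ)).trans (Equiv.curry A B ℤˣ)
  rw [← logPartition_sum_pi, ← logPartition_comp_equiv φ]
  congr 1 with σ
  have hfield : ∑ x, g x * ((σ x : ℤ) : ℝ)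
      = ∑ a, ∑ b, g (e (a, b)) * ((σ (e (a, b)) : ℤ) : ℝ) := by
    rw [← e.sum_comp, Fintype.sum_prod_type]
  simp only [fieldEnergy, hfield, Finset.sum_add_distrib, Finset.mul_sum]
  rfl

theorem meanLogPartition_blocks {A B : Type*} [Fintype A] [Fintype B]
    [DecidableEq B] (e : A × B ≃ V) (H : (B → ℤˣ) → ℝ) (h : ℝ) :
    meanLogPartition (fun σ : V → ℤˣ => ∑ a, H fun b => σ (e (a, b))) h
      = Fintype.card A * meanLogPartition H h := by
  have hblock : ∀ a, MeasurePreserving (fun (g : V → ℝ) b => g (e (a, b)))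
      (stdGaussianPi V) (stdGaussianPi B) := fun a =>
    measurePreserving_pi_comp _ (e.injective.comp (Prod.mk_right_injective a))
  have hint := integrable_logPartition_fieldEnergy H h
  have hblockInt : ∀ a, Integrable
      (fun g : V → ℝ => logPartition (fieldEnergy H h fun b => g (e (a, b)))) (stdGaussianPi V) :=
    fun a => (hblock a).integrable_comp_of_integrable hint
  unfold meanLogPartition
  simp only [logPartition_fieldEnergy_blocks]
  rw [integral_finsetSum _ fun a _ => hblockInt a]
  simp [← integral_eq_integral_comp (hblock _) hint.aestronglyMeasurable]

end FreeEnergy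

section Overlap

variable {V : Type*} [Fintype V]

/-- The overlap `|V|⁻¹ ∑ₓ σₓ τₓ`. -/
noncomputable def overlap (σ τ : V → ℤˣ) : ℝ :=
  (∑ x, ((σ x : ℤ) : ℝ) * ((τ x : ℤ) : ℝ)) / Fintype.card V

/-- The field energy per site `|V|⁻¹ ∑ₓ gₓ σₓ`, conjugate to `h`. -/
noncomputable def fieldDensity (g : V → ℝ) (σ : V → ℤˣ) : ℝ :=
  (∑ x, g x * ((σ x : ℤ) : ℝ)) / Fintype.card V

theorem overlap_self [Nonempty V] (σ : V → ℤˣ) : overlap σ σ = 1 := by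
  have hsq : ∀ x, ((σ x : ℤ) : ℝ) * ((σ x : ℤ) : ℝ) = 1 := fun x => by
    rw [← abs_mul_abs_self, abs_unit_cast, one_mul]
  simp [overlap, hsq]

theorem abs_overlap_le_one (σ τ : V → ℤˣ) : |overlap σ τ| ≤ 1 := by
  have hsum : |∑ x, ((σ x : ℤ) : ℝ) * ((τ x : ℤ) : ℝ)| ≤ Fintype.card V :=
    (Finset.abs_sum_le_sum_abs _ _).trans_eq (by simp [abs_mul, abs_unit_cast])
  rw [overlap, abs_div, Nat.abs_cast]
  exact div_le_one_of_le₀ hsum (Nat.cast_nonneg _)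

theorem sum_overlap_sub_mul_overlap {α : Type*} [Fintype α] (c : ℝ) (σ ρ : V → ℤˣ)
    (τ : α → V → ℤˣ) :
    ∑ i, overlap σ (τ i) - c * overlap σ ρ = (Fintype.card V : ℝ)⁻¹
      * ∑ x, ((σ x : ℤ) : ℝ) * (∑ i, ((τ i x : ℤ) : ℝ) - c * ((ρ x : ℤ) : ℝ)) := by
  simp only [overlap, mul_sub, Finset.sum_sub_distrib, Finset.mul_sum,
    div_eq_inv_mul, mul_left_comm c]
  rw [Finset.sum_comm]

end Overlap

section QuenchedAverage

variable {V : Type*} [Fintype V] [DecidableEq V] {ι κ : Type*} [Fintype ι] [DecidableEq ι]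
  [Fintype κ] [DecidableEq κ] {H : (V → ℤˣ) → ℝ} {h : ℝ}

/-- The quenched average `𝔼⟨F⟩` over replicas indexed by `ι`. -/
noncomputable def quenchedAvg (H : (V → ℤˣ) → ℝ) (h : ℝ) (F : (ι → V → ℤˣ) → ℝ) : ℝ :=
  ∫ g, replicaAvg (gibbs (fieldEnergy H h g)) F ∂(stdGaussianPi V)

theorem exists_forall_abs_le {S : Type*} [Finite S] (F : S → ℝ) : ∃ C, ∀ s, |F s| ≤ C := by
  obtain ⟨C, hC⟩ := Finite.bddAbove_range fun s => |F s|
  exact ⟨C, fun s => hC ⟨s, rfl⟩⟩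

theorem integrable_replicaAvg (F : (ι → V → ℤˣ) → ℝ) :
    Integrable (fun g => replicaAvg (gibbs (fieldEnergy H h g)) F) (stdGaussianPi V) := by
  obtain ⟨C, hC⟩ := exists_forall_abs_le F
  exact Integrable.of_bound
    (continuous_replicaAvg_gibbs (continuous_fieldEnergy H h) F).aestronglyMeasurable C
    (ae_of_all _ fun _ => abs_replicaAvg_le (gibbs_mem_stdSimplex _) hC)

theorem integrable_eval_mul_replicaAvg (F : (ι → V → ℤˣ) → ℝ) (x : V) :
    Integrable (fun g => g x * replicaAvg (gibbs (fieldEnergy H h g)) F) (stdGaussianPi V) := by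
  obtain ⟨C, hC⟩ := exists_forall_abs_le F
  exact (integrable_eval_stdGaussianPi x).mul_bdd
    (continuous_replicaAvg_gibbs (continuous_fieldEnergy H h) F).aestronglyMeasurable
    (ae_of_all _ fun _ => abs_replicaAvg_le (gibbs_mem_stdSimplex _) hC)

theorem quenchedAvg_sub (F G : (ι → V → ℤˣ) → ℝ) :
    quenchedAvg H h (fun s => F s - G s) = quenchedAvg H h F - quenchedAvg H h G := by
  simp only [quenchedAvg, replicaAvg_sub]
  exact integral_sub (integrable_replicaAvg F) (integrable_replicaAvg G)

theorem quenchedAvg_const_mul (c : ℝ) (F : (ι → V → ℤˣ) → ℝ) :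
    quenchedAvg H h (fun s => c * F s) = c * quenchedAvg H h F := by
  simp only [quenchedAvg, replicaAvg_const_mul]
  exact integral_const_mul _ _

theorem quenchedAvg_sum {α : Type*} (t : Finset α) (F : α → (ι → V → ℤˣ) → ℝ) :
    quenchedAvg H h (fun s => ∑ a ∈ t, F a s) = ∑ a ∈ t, quenchedAvg H h (F a) := by
  simp only [quenchedAvg, replicaAvg_sum]
  exact integral_finsetSum _ fun a _ => integrable_replicaAvg (F a)

theorem quenchedAvg_const (c : ℝ) : quenchedAvg H h (fun _ : ι → V → ℤˣ => c) = c := by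
  simp [quenchedAvg, replicaAvg_const (gibbs_mem_stdSimplex _).2]

theorem quenchedAvg_comp_injective {e : κ → ι} (he : Function.Injective e)
    (F : (κ → V → ℤˣ) → ℝ) :
    quenchedAvg H h (fun s : ι → V → ℤˣ => F fun j => s (e j)) = quenchedAvg H h F := by
  simp only [quenchedAvg, replicaAvg_comp_injective (gibbs_mem_stdSimplex _).2 he F]

theorem abs_quenchedAvg_le {F : (ι → V → ℤˣ) → ℝ} {C : ℝ} (hF : ∀ s, |F s| ≤ C) :
    |quenchedAvg H h F| ≤ C := by
  have hbound : ∀ g : V → ℝ, ‖replicaAvg (gibbs (fieldEnergy H h g)) F‖ ≤ C := fun _ =>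
    abs_replicaAvg_le (gibbs_mem_stdSimplex _) hF
  simpa [quenchedAvg] using
    norm_integral_le_of_norm_le_const (μ := stdGaussianPi V) (ae_of_all _ hbound)

end QuenchedAverage

section IntegrationByParts

variable {V : Type*} [Fintype V] [DecidableEq V] (H : (V → ℤˣ) → ℝ) (h : ℝ) {m : ℕ}

theorem hasDerivAt_fieldEnergy_update (g : V → ℝ) (x : V) (σ : V → ℤˣ) (t : ℝ) :
    HasDerivAt (fun t => fieldEnergy H h (Function.update g x t) σ) (h * ((σ x : ℤ) : ℝ)) t := by
  have hcoord : ∀ y, HasDerivAt (fun t => Function.update g x t y * ((σ y : ℤ) : ℝ))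
      (if y = x then ((σ x : ℤ) : ℝ) else 0) t := fun y => by
    rcases eq_or_ne y x with rfl | hy
    · simpa using (hasDerivAt_id t).mul_const ((σ y : ℤ) : ℝ)
    · simpa [hy] using hasDerivAt_const t (g y * ((σ y : ℤ) : ℝ))
  simpa [fieldEnergy] using
    ((HasDerivAt.fun_sum fun y (_ : y ∈ Finset.univ) => hcoord y).const_mul h).const_add (H σ)

theorem integral_eval_mul_replicaAvg (F : (Fin m → V → ℤˣ) → ℝ) (x : V) :
    ∫ g, g x * replicaAvg (gibbs (fieldEnergy H h g)) F ∂(stdGaussianPi V)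
      = h * quenchedAvg H h fun s : Fin (m + 1) → V → ℤˣ => F (fun i => s i.castSucc)
          * (∑ i : Fin m, ((s i.castSucc x : ℤ) : ℝ) - m * ((s (Fin.last m) x : ℤ) : ℝ)) := by
  have hfactor : ∀ s : Fin (m + 1) → V → ℤˣ, h * (F (fun i => s i.castSucc)
        * (∑ i : Fin m, ((s i.castSucc x : ℤ) : ℝ) - m * ((s (Fin.last m) x : ℤ) : ℝ)))
      = F (fun i => s i.castSucc) * (∑ i : Fin m, h * ((s i.castSucc x : ℤ) : ℝ)
        - m * (h * ((s (Fin.last m) x : ℤ) : ℝ))) := fun s => by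
    rw [← Finset.mul_sum]
    ring
  simp only [← quenchedAvg_const_mul, hfactor]
  obtain ⟨C, hC⟩ := exists_forall_abs_le F
  obtain ⟨C', hC'⟩ := exists_forall_abs_le fun s : Fin (m + 1) → V → ℤˣ => F (fun i => s i.castSucc)
    * (∑ i : Fin m, h * ((s i.castSucc x : ℤ) : ℝ) - m * (h * ((s (Fin.last m) x : ℤ) : ℝ)))
  have hcont := continuous_fieldEnergy H h
  have hderiv := fun (g : V → ℝ) t => hasDerivAt_replicaAvg_gibbs
    (E := fun t => fieldEnergy H h (Function.update g x t)) F
    fun σ => hasDerivAt_fieldEnergy_update H h g x σ t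
  exact integral_eval_mul_stdGaussianPi x (continuous_replicaAvg_gibbs hcont F)
    (continuous_replicaAvg_gibbs hcont _) hderiv
    (fun g => abs_replicaAvg_le (gibbs_mem_stdSimplex _) hC)
    fun g => abs_replicaAvg_le (gibbs_mem_stdSimplex _) hC'

theorem replicaAvg_mul_fieldDensity {ι : Type*} [Fintype ι] [DecidableEq ι] (w : (V → ℤˣ) → ℝ)
    (g : V → ℝ) (F : (ι → V → ℤˣ) → ℝ) (i₀ : ι) :
    replicaAvg w (fun s => F s * fieldDensity g (s i₀))
      = (Fintype.card V : ℝ)⁻¹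
        * ∑ x, g x * replicaAvg w fun s => F s * ((s i₀ x : ℤ) : ℝ) := by
  simp only [← replicaAvg_const_mul, ← replicaAvg_sum, fieldDensity, div_eq_inv_mul,
    Finset.mul_sum, mul_left_comm (F _)]

theorem integrable_replicaAvg_mul_fieldDensity {ι : Type*} [Fintype ι] [DecidableEq ι]
    (F : (ι → V → ℤˣ) → ℝ) (i₀ : ι) :
    Integrable (fun g => replicaAvg (gibbs (fieldEnergy H h g))
      fun s => F s * fieldDensity g (s i₀)) (stdGaussianPi V) := by
  simp only [replicaAvg_mul_fieldDensity]
  exact (integrable_finsetSum _ fun x _ => integrable_eval_mul_replicaAvg _ x).const_mul _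

theorem integral_replicaAvg_mul_fieldDensity (F : (Fin m → V → ℤˣ) → ℝ) (i₀ : Fin m) :
    ∫ g, replicaAvg (gibbs (fieldEnergy H h g)) (fun s => F s * fieldDensity g (s i₀))
        ∂(stdGaussianPi V)
      = h * (∑ i : Fin m, quenchedAvg H h (fun s : Fin (m + 1) → V → ℤˣ =>
            F (fun i => s i.castSucc) * overlap (s i₀.castSucc) (s i.castSucc))
          - m * quenchedAvg H h fun s : Fin (m + 1) → V → ℤˣ =>
            F (fun i => s i.castSucc) * overlap (s i₀.castSucc) (s (Fin.last m))) := by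
  simp only [replicaAvg_mul_fieldDensity]
  rw [integral_const_mul, integral_finsetSum _ fun x _ => integrable_eval_mul_replicaAvg _ x]
  simp only [integral_eval_mul_replicaAvg, ← quenchedAvg_sum, ← Finset.mul_sum]
  rw [mul_left_comm]
  simp only [← quenchedAvg_const_mul, ← quenchedAvg_sub]
  congr 1 with s
  simp only [mul_assoc, mul_left_comm _ (F _), ← Finset.mul_sum, ← mul_sub,
    sum_overlap_sub_mul_overlap]

end IntegrationByParts

theorem integral_const_add_add {Ω : Type*} [MeasurableSpace Ω] {μ : Measure Ω}
    [IsProbabilityMeasure μ] (c : ℝ) {f g : Ω → ℝ} (hf : Integrable f μ) (hg : Integrable g μ) :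
    ∫ ω, c + (f ω + g ω) ∂μ = c + (∫ ω, f ω ∂μ + ∫ ω, g ω ∂μ) := by
  have hadd := integral_add (integrable_const c) (hf.add hg)
  simp only [Pi.add_apply] at hadd
  rw [hadd, integral_add hf hg, integral_const, probReal_univ, one_smul]

section FieldIncrement

variable {V : Type*} [Fintype V]

theorem integrable_fieldDensity (σ : V → ℤˣ) :
    Integrable (fun g => fieldDensity g σ) (stdGaussianPi V) :=
  (integrable_finsetSum _ fun x _ => (integrable_eval_stdGaussianPi x).mul_const _).div_const _

theorem fieldEnergy_add [Nonempty V] (H : (V → ℤˣ) → ℝ) (h t : ℝ) (g : V → ℝ) (σ : V → ℤˣ) :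
    fieldEnergy H (h + t) g σ
      = fieldEnergy H h g σ + t * (Fintype.card V * fieldDensity g σ) := by
  rw [fieldDensity, mul_div_cancel₀ _ (Nat.cast_ne_zero.2 Fintype.card_ne_zero)]
  unfold fieldEnergy
  ring

end FieldIncrement

section Concentration

variable {V : Type*} [Fintype V] [DecidableEq V] (H : (V → ℤˣ) → ℝ) (h : ℝ)

/-- The quenched mean deviation `𝔼⟨|e - q|⟩` from `q` of the field energy per site `e`. -/
noncomputable def fieldDeviation (q : ℝ) : ℝ :=
  ∫ g, ∑ σ, gibbs (fieldEnergy H h g) σ * |fieldDensity g σ - q| ∂(stdGaussianPi V)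

theorem fieldDeviation_nonneg (q : ℝ) : 0 ≤ fieldDeviation H h q :=
  integral_nonneg fun _ => Finset.sum_nonneg fun σ _ =>
    mul_nonneg ((gibbs_mem_stdSimplex _).1 σ) (abs_nonneg _)

theorem integrable_sum_gibbs_mul_abs_fieldDensity_sub (q : ℝ) :
    Integrable (fun g => ∑ σ, gibbs (fieldEnergy H h g) σ * |fieldDensity g σ - q|)
      (stdGaussianPi V) := by
  refine integrable_finsetSum _ fun σ _ =>
    ((integrable_fieldDensity σ).sub (integrable_const q)).abs.bdd_mul (c := 1)
      (continuous_gibbs (continuous_fieldEnergy H h) σ).aestronglyMeasurable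
      (ae_of_all _ fun g => ?_)
  obtain ⟨hnonneg, hsum⟩ := gibbs_mem_stdSimplex (fieldEnergy H h g)
  rw [Real.norm_of_nonneg (hnonneg σ), ← hsum]
  exact Finset.single_le_sum (fun τ _ => hnonneg τ) (Finset.mem_univ σ)

theorem abs_integral_replicaAvg_mul_fieldDensity_sub_le {ι : Type*} [Fintype ι] [DecidableEq ι]
    (q : ℝ) {F : (ι → V → ℤˣ) → ℝ} {C : ℝ} (hF : ∀ s, |F s| ≤ C) (i₀ : ι) :
    |∫ g, replicaAvg (gibbs (fieldEnergy H h g)) (fun s => F s * fieldDensity g (s i₀))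
        ∂(stdGaussianPi V) - q * quenchedAvg H h F| ≤ C * fieldDeviation H h q := by
  unfold quenchedAvg fieldDeviation
  rw [← integral_const_mul, ← integral_const_mul,
    ← integral_sub (integrable_replicaAvg_mul_fieldDensity H h F i₀)
      ((integrable_replicaAvg F).const_mul q),
    ← Real.norm_eq_abs]
  refine norm_integral_le_of_norm_le
    ((integrable_sum_gibbs_mul_abs_fieldDensity_sub H h q).const_mul C) (ae_of_all _ fun g => ?_)
  have hw := gibbs_mem_stdSimplex (fieldEnergy H h g)
  rw [Real.norm_eq_abs, ← replicaAvg_single hw.2 i₀ fun σ => |fieldDensity g σ - q|,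
    ← replicaAvg_const_mul, ← replicaAvg_const_mul, ← replicaAvg_sub]
  refine abs_replicaAvg_le_replicaAvg hw.1 fun s => ?_
  rw [mul_comm q, ← mul_sub, abs_mul]
  exact mul_le_mul_of_nonneg_right (hF s) (abs_nonneg _)

theorem logPartition_fieldEnergy_add [Nonempty V] (q t : ℝ) (g : V → ℝ) :
    logPartition (fun σ => fieldEnergy H h g σ + t * (Fintype.card V * (fieldDensity g σ - q)))
      = logPartition (fieldEnergy H (h + t) g) - t * (Fintype.card V * q) := by
  rw [sub_eq_add_neg, ← logPartition_add_const]
  congr 1 with σ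
  rw [fieldEnergy_add]
  ring

/-- The free energy per site `|V|⁻¹ 𝔼 log Z`. -/
noncomputable def freeEnergy : ℝ :=
  meanLogPartition H h / Fintype.card V

/-- A bound, per site, for the mean distance between the increment of `log Z` from the field
strength `h` to `h + t` and its linear prediction of slope `q`: the error of the prediction for
the mean, plus the fluctuations of the two values of `log Z`. -/
noncomputable def incrementError (q t : ℝ) : ℝ :=
  |freeEnergy H (h + t) - freeEnergy H h - t * q| + (|h + t| + |h|) / √(Fintype.card V)

theorem card_mul_incrementError [Nonempty V] (q t : ℝ) :
    Fintype.card V * incrementError H h q t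
      = |meanLogPartition H (h + t) - meanLogPartition H h - t * (Fintype.card V * q)|
        + (|h + t| + |h|) * √(Fintype.card V) := by
  have hcard : (0 : ℝ) < Fintype.card V := Nat.cast_pos.2 Fintype.card_pos
  rw [incrementError, mul_add, mul_div_left_comm, Real.div_sqrt]
  congr 1
  rw [← abs_of_pos hcard, ← abs_mul, abs_of_pos hcard]
  congr 1
  unfold freeEnergy
  field_simp

theorem integral_abs_logPartition_increment_sub_le [Nonempty V] (q t : ℝ) :
    ∫ g, |logPartition (fieldEnergy H (h + t) g) - logPartition (fieldEnergy H h g)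
        - t * (Fintype.card V * q)| ∂(stdGaussianPi V)
      ≤ Fintype.card V * incrementError H h q t := by
  set c := t * (Fintype.card V * q)
  have hdev : ∀ u, Integrable
      (fun g => |logPartition (fieldEnergy H u g) - meanLogPartition H u|) (stdGaussianPi V) :=
    fun u => ((integrable_logPartition_fieldEnergy H u).sub (integrable_const _)).abs
  have htriangle : ∀ g : V → ℝ,
      |logPartition (fieldEnergy H (h + t) g) - logPartition (fieldEnergy H h g) - c|
        ≤ |meanLogPartition H (h + t) - meanLogPartition H h - c|
          + (|logPartition (fieldEnergy H (h + t) g) - meanLogPartition H (h + t)|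
            + |logPartition (fieldEnergy H h g) - meanLogPartition H h|) := fun g => by
    refine le_trans (le_of_eq ?_) ((abs_add_le _ _).trans (add_le_add le_rfl (abs_sub _ _)))
    ring_nf
  refine (integral_mono_of_nonneg (ae_of_all _ fun _ => abs_nonneg _)
    ((integrable_const _).add ((hdev (h + t)).add (hdev h))) (ae_of_all _ htriangle)).trans ?_
  simp only [Pi.add_apply]
  rw [integral_const_add_add _ (hdev (h + t)) (hdev h), card_mul_incrementError, add_mul]
  gcongr <;> exact integral_abs_logPartition_sub_mean_le H _

theorem mul_sum_gibbs_mul_abs_fieldDensity_sub_le [Nonempty V] (q : ℝ) {δ : ℝ} (hδ : 0 ≤ δ)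
    (g : V → ℝ) :
    δ * (Fintype.card V * ∑ σ, gibbs (fieldEnergy H h g) σ * |fieldDensity g σ - q|)
      ≤ Real.log 2 + (|logPartition (fieldEnergy H (h + δ) g) - logPartition (fieldEnergy H h g)
          - δ * (Fintype.card V * q)|
        + |logPartition (fieldEnergy H (h + -δ) g) - logPartition (fieldEnergy H h g)
          - -δ * (Fintype.card V * q)|) := by
  have hgibbs := sum_gibbs_mul_abs_le (fieldEnergy H h g)
    fun σ => δ * (Fintype.card V * (fieldDensity g σ - q))
  simp only [← neg_mul, logPartition_fieldEnergy_add, abs_mul, abs_of_nonneg hδ, Nat.abs_cast,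
    sub_right_comm _ (_ * (_ * q))] at hgibbs
  simpa only [Finset.mul_sum, mul_left_comm] using hgibbs

theorem mul_fieldDeviation_le [Nonempty V] (q : ℝ) {δ : ℝ} (hδ : 0 ≤ δ) :
    δ * fieldDeviation H h q ≤ Real.log 2 / Fintype.card V
      + (incrementError H h q δ + incrementError H h q (-δ)) := by
  have hincr : ∀ t, Integrable (fun g => |logPartition (fieldEnergy H (h + t) g)
      - logPartition (fieldEnergy H h g) - t * (Fintype.card V * q)|) (stdGaussianPi V) := fun t =>
    (((integrable_logPartition_fieldEnergy H _).sub (integrable_logPartition_fieldEnergy H h)).sub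
      (integrable_const _)).abs
  have hmean := integral_mono
    (((integrable_sum_gibbs_mul_abs_fieldDensity_sub H h q).const_mul _).const_mul δ)
    ((integrable_const _).add ((hincr δ).add (hincr (-δ))))
    (mul_sum_gibbs_mul_abs_fieldDensity_sub_le H h q hδ)
  simp only [Pi.add_apply] at hmean
  rw [integral_const_mul, integral_const_mul,
    integral_const_add_add _ (hincr δ) (hincr (-δ))] at hmean
  have hcard : (0 : ℝ) < Fintype.card V := Nat.cast_pos.2 Fintype.card_pos
  rw [div_add' _ _ _ hcard.ne', le_div_iff₀ hcard]
  unfold fieldDeviation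
  linarith [integral_abs_logPartition_increment_sub_le H h q δ,
    integral_abs_logPartition_increment_sub_le H h q (-δ)]

end Concentration

section Limit

variable {ι : Type*} {l : Filter ι} {V : ι → Type*} [∀ i, Fintype (V i)] [∀ i, DecidableEq (V i)]
  {H : ∀ i, (V i → ℤˣ) → ℝ} {P : ℝ → ℝ}

theorem tendsto_incrementError (hV : Tendsto (fun i => Fintype.card (V i)) l atTop)
    (hP : ∀ t, Tendsto (fun i => freeEnergy (H i) t) l (nhds (P t))) (h q t : ℝ) :
    Tendsto (fun i => incrementError (H i) h q t) l (nhds |P (h + t) - P h - t * q|) := by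
  have hsqrt : Tendsto (fun i => √(Fintype.card (V i) : ℝ)) l atTop :=
    Real.tendsto_sqrt_atTop.comp (tendsto_natCast_atTop_atTop.comp hV)
  simpa [incrementError] using
    (((hP (h + t)).sub (hP h)).sub_const (t * q)).abs.add (hsqrt.const_div_atTop (|h + t| + |h|))

theorem tendsto_fieldDeviation (hV : Tendsto (fun i => Fintype.card (V i)) l atTop)
    (hP : ∀ t, Tendsto (fun i => freeEnergy (H i) t) l (nhds (P t))) {h q : ℝ}
    (hq : HasDerivAt P q h) :
    Tendsto (fun i => fieldDeviation (H i) h q) l (nhds 0) := by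
  rw [Metric.tendsto_nhds]
  intro ε hε
  obtain ⟨r, hr, hlinear⟩ := Metric.eventually_nhds_iff.1
    ((hasDerivAt_iff_isLittleO_nhds_zero.1 hq).bound (show 0 < ε / 4 by positivity))
  have hδ : 0 < r / 2 := by positivity
  have hincr : ∀ t, |t| = r / 2 → |P (h + t) - P h - t * q| ≤ ε / 4 * (r / 2) := fun t ht => by
    simpa [ht] using hlinear (y := t) (by rw [dist_zero_right, Real.norm_eq_abs, ht]; linarith)
  have hlog : Tendsto (fun i => Real.log 2 / (Fintype.card (V i) : ℝ)) l (nhds 0) :=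
    (tendsto_natCast_atTop_atTop.comp hV).const_div_atTop _
  have hbound := (hlog.add ((tendsto_incrementError hV hP h q (r / 2)).add
    (tendsto_incrementError hV hP h q (-(r / 2))))).eventually_lt_const (u := ε * (r / 2)) (by
      have hpos := hincr _ (abs_of_pos hδ)
      have hneg := hincr _ ((abs_neg _).trans (abs_of_pos hδ))
      nlinarith)
  filter_upwards [hbound, hV.eventually_gt_atTop 0] with i hi hcard
  have := Fintype.card_pos_iff.1 hcard
  rw [dist_zero_right, Real.norm_of_nonneg (fieldDeviation_nonneg _ _ _)]
  exact lt_of_mul_lt_mul_left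
    ((mul_fieldDeviation_le (H i) h q hδ.le).trans_lt (hi.trans_eq (mul_comm _ _))) hδ.le

end Limit

section GhirlandaGuerra

theorem sum_castSucc_eq_add_sum_Ioo {k : ℕ} [NeZero k] (G : Fin (k + 1) → ℝ) :
    ∑ i : Fin k, G i.castSucc = G 0 + ∑ i ∈ Finset.Ioo 0 (Fin.last k), G i := by
  rw [Finset.add_sum_Ioo_eq_sum_Ico Fin.last_pos', ← bot_eq_zero, Finset.Ico_bot,
    Fin.Iio_last_eq_map, Finset.sum_map]
  rfl

variable {V : Type*} [Fintype V] [DecidableEq V] (H : (V → ℤˣ) → ℝ) (h : ℝ) {k : ℕ}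

/-- The defect in the first Ghirlanda–Guerra identity for the test function `F` of the first `k`
among `k + 1` replicas. -/
noncomputable def ghirlandaGuerraDefect (F : (Fin k → V → ℤˣ) → ℝ) : ℝ :=
  quenchedAvg H h (fun s : Fin (k + 1) → V → ℤˣ =>
      F (fun i => s i.castSucc) * overlap (s 0) (s (Fin.last k)))
    - (1 / (k : ℝ)) * quenchedAvg H h (fun s : Fin (k + 1) → V → ℤˣ => F fun i => s i.castSucc)
      * quenchedAvg H h (fun s : Fin (k + 1) → V → ℤˣ => overlap (s 0) (s 1))
    - (1 / (k : ℝ)) * ∑ i ∈ Finset.Ioo (0 : Fin (k + 1)) (Fin.last k),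
        quenchedAvg H h (fun s : Fin (k + 1) → V → ℤˣ =>
          F (fun i => s i.castSucc) * overlap (s 0) (s i))

variable [Nonempty V] [NeZero k]

theorem integral_replicaAvg_fieldDensity :
    ∫ g, replicaAvg (gibbs (fieldEnergy H h g))
        (fun s : Fin 1 → V → ℤˣ => 1 * fieldDensity g (s 0)) ∂(stdGaussianPi V)
      = h * (1 - quenchedAvg H h fun s : Fin (k + 1) → V → ℤˣ => overlap (s 0) (s 1)) := by
  have htwo : quenchedAvg H h (fun s : Fin (k + 1) → V → ℤˣ => overlap (s 0) (s 1))
      = quenchedAvg H h fun s : Fin 2 → V → ℤˣ => overlap (s 0) (s 1) := by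
    have hne : (0 : Fin (k + 1)) ≠ 1 := by
      obtain ⟨j, rfl⟩ := Nat.exists_eq_succ_of_ne_zero (NeZero.ne k)
      exact Fin.zero_ne_one
    have hinj : Function.Injective ![(0 : Fin (k + 1)), 1] := by
      intro i j
      fin_cases i <;> fin_cases j <;> simp [hne, hne.symm]
    exact quenchedAvg_comp_injective hinj fun s : Fin 2 → V → ℤˣ => overlap (s 0) (s 1)
  rw [integral_replicaAvg_mul_fieldDensity H h (fun _ : Fin 1 → V → ℤˣ => 1), htwo]
  simp [overlap_self, quenchedAvg_const]

theorem mul_ghirlandaGuerraDefect_eq (F : (Fin k → V → ℤˣ) → ℝ) (q : ℝ) :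
    h * k * ghirlandaGuerraDefect H h F
      = quenchedAvg H h F * (∫ g, replicaAvg (gibbs (fieldEnergy H h g))
          (fun s : Fin 1 → V → ℤˣ => 1 * fieldDensity g (s 0)) ∂(stdGaussianPi V) - q)
        - (∫ g, replicaAvg (gibbs (fieldEnergy H h g)) (fun s => F s * fieldDensity g (s 0))
          ∂(stdGaussianPi V) - q * quenchedAvg H h F) := by
  have hsum := sum_castSucc_eq_add_sum_Ioo fun i => quenchedAvg H h fun s : Fin (k + 1) → V → ℤˣ =>
    F (fun j => s j.castSucc) * overlap (s 0) (s i)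
  have hk : (k : ℝ) ≠ 0 := Nat.cast_ne_zero.2 (NeZero.ne k)
  simp only [overlap_self, mul_one] at hsum
  rw [integral_replicaAvg_fieldDensity (k := k), integral_replicaAvg_mul_fieldDensity,
    Fin.castSucc_zero', hsum, ← quenchedAvg_comp_injective (Fin.castSucc_injective k) F]
  unfold ghirlandaGuerraDefect
  field_simp
  ring

theorem abs_mul_ghirlandaGuerraDefect_le {F : (Fin k → V → ℤˣ) → ℝ} {C : ℝ} (hF : ∀ s, |F s| ≤ C)
    (q : ℝ) : |h * k * ghirlandaGuerraDefect H h F| ≤ 2 * C * fieldDeviation H h q := by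
  have hmean := abs_integral_replicaAvg_mul_fieldDensity_sub_le H h q
    (F := fun _ : Fin 1 → V → ℤˣ => 1) (fun _ => abs_one.le) 0
  have htest := abs_integral_replicaAvg_mul_fieldDensity_sub_le H h q hF 0
  rw [quenchedAvg_const, mul_one, one_mul] at hmean
  rw [mul_ghirlandaGuerraDefect_eq H h F q]
  calc
    _ ≤ C * fieldDeviation H h q + C * fieldDeviation H h q := by
      refine (abs_sub _ _).trans (add_le_add ?_ htest)
      have hquenched : |quenchedAvg H h F| ≤ C := abs_quenchedAvg_le hF
      rw [abs_mul]
      exact mul_le_mul hquenched hmean (abs_nonneg _) ((abs_nonneg _).trans hquenched)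
    _ = _ := by ring

end GhirlandaGuerra

theorem cauchySeq_of_abs_sub_mul_le {u : ℕ → ℝ} {C : ℝ}
    (hu : ∀ m n : ℕ, 0 < m → 0 < n → |u (m * n) - u n| ≤ C / n) : CauchySeq u := by
  have hC : 0 ≤ C := by simpa using (abs_nonneg _).trans (hu 1 1 one_pos one_pos)
  have hdist : ∀ m n : ℕ, 0 < m → 0 < n → |u m - u n| ≤ C / m + C / n := fun m n hm hn =>
    calc |u m - u n| ≤ |u m - u (n * m)| + |u (n * m) - u n| := abs_sub_le _ _ _
      _ ≤ C / m + C / n := by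
        rw [abs_sub_comm (u m)]
        refine add_le_add (hu n m hn hm) ?_
        rw [mul_comm]
        exact hu m n hm hn
  rw [Metric.cauchySeq_iff']
  intro ε hε
  obtain ⟨N, hN⟩ := exists_nat_gt (2 * C / ε)
  have hN0 : (0 : ℝ) < N := lt_of_le_of_lt (by positivity) hN
  refine ⟨N, fun n hn => ?_⟩
  have hNn : (N : ℝ) ≤ n := Nat.cast_le.2 hn
  rw [Real.dist_eq]
  calc |u n - u N| ≤ C / n + C / N :=
        hdist n N (Nat.cast_pos.1 (hN0.trans_le hNn)) (Nat.cast_pos.1 hN0)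
    _ ≤ C / N + C / N := by gcongr
    _ = 2 * C / N := by ring
    _ < ε := by rwa [div_lt_comm₀ hN0 hε]

theorem abs_sum_sub_sum_blocks_le {V A B : Type*} [Fintype V] [Fintype A] [Fintype B]
    (e : A × B ≃ V) {G G' : V → V → ℝ} (hG : ∀ x y, |G x y| ≤ G' x y) :
    |∑ x, ∑ y, G x y - ∑ a, ∑ b, ∑ b', G (e (a, b)) (e (a, b'))|
      ≤ ∑ x, ∑ y, G' x y - ∑ a, ∑ b, ∑ b', G' (e (a, b)) (e (a, b')) := by
  classical
  have hcross : ∀ K : V → V → ℝ,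
      ∑ x, ∑ y, K x y - ∑ a, ∑ b, ∑ b', K (e (a, b)) (e (a, b'))
        = ∑ a, ∑ b, ∑ a' ∈ Finset.univ.erase a, ∑ b', K (e (a, b)) (e (a', b')) := fun K => by
    simp only [← e.sum_comp, Fintype.sum_prod_type, ← Finset.sum_sub_distrib]
    simp only [← Finset.sum_erase_eq_sub (Finset.mem_univ _)]
  rw [hcross, hcross]
  refine (Finset.abs_sum_le_sum_abs _ _).trans (Finset.sum_le_sum fun a _ => ?_)
  refine (Finset.abs_sum_le_sum_abs _ _).trans (Finset.sum_le_sum fun b _ => ?_)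
  refine (Finset.abs_sum_le_sum_abs _ _).trans (Finset.sum_le_sum fun a' _ => ?_)
  exact (Finset.abs_sum_le_sum_abs _ _).trans (Finset.sum_le_sum fun b' _ => hG _ _)

end RandomField

namespace RFIM

open MeasureTheory ProbabilityTheory Filter

section NeighborCount

open Polynomial in
theorem coeff_one_pow_eq (p : ℝ[X]) (d : ℕ) :
    (p ^ d).coeff 1 = d * p.coeff 0 ^ (d - 1) * p.coeff 1 := by
  have hderiv : ∀ r : ℝ[X], r.coeff 1 = (derivative r).coeff 0 := fun r => by
    simp [coeff_derivative]
  rw [hderiv, derivative_pow, hderiv p]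
  simp [coeff_zero_eq_eval_zero]

theorem sum_sum_abs_sub_eq_one {n : ℕ} (hn : 0 < n) :
    ∑ u ∈ Finset.Icc (1 : ℤ) n, ∑ v ∈ Finset.Icc (1 : ℤ) n, (if |u - v| = 1 then (1 : ℝ) else 0)
      = 2 * (n - 1) := by
  have hsplit : ∀ u v : ℤ, (if |u - v| = 1 then (1 : ℝ) else 0)
      = (if u + 1 = v then 1 else 0) + if v + 1 = u then 1 else 0 := fun u v => by
    have habs : |u - v| = 1 ↔ u + 1 = v ∨ v + 1 = u := by
      rw [abs_eq zero_le_one]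
      omega
    simp only [habs]
    grind
  have hsucc : ∑ u ∈ Finset.Icc (1 : ℤ) n, ∑ v ∈ Finset.Icc (1 : ℤ) n,
      (if u + 1 = v then (1 : ℝ) else 0) = n - 1 := by
    have hfilter : (Finset.Icc (1 : ℤ) n).filter (fun u => u + 1 ∈ Finset.Icc (1 : ℤ) n)
        = Finset.Icc 1 (n - 1 : ℤ) := by
      ext u
      simp only [Finset.mem_filter, Finset.mem_Icc]
      omega
    simp only [Finset.sum_ite_eq, ← Finset.sum_filter, hfilter]
    simp [Nat.cast_sub (Nat.one_le_iff_ne_zero.2 hn.ne')]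
  simp only [hsplit, Finset.sum_add_distrib]
  rw [Finset.sum_comm (f := fun u v : ℤ => if v + 1 = u then (1 : ℝ) else 0), hsucc]
  ring

/-- The number of ordered pairs of neighbours in `V_n`. -/
noncomputable def neighborCount (d n : ℕ) : ℝ :=
  ∑ x : box d n, ∑ y : box d n, if Neighbors (x : Fin d → ℤ) y then 1 else 0

open Polynomial in
theorem neighborCount_eq_coeff (d n : ℕ) :
    neighborCount d n = ((∑ u ∈ Finset.Icc (1 : ℤ) n, ∑ v ∈ Finset.Icc (1 : ℤ) n,
      (X : ℝ[X]) ^ (u - v).natAbs) ^ d).coeff 1 := by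
  -- The `ℓ¹`-distance adds up over coordinates, so the generating polynomial of the distances
  -- between points of `V_n` is the `d`-th power of that of `[1,n]`.
  have hpow : ∀ x y : Fin d → ℤ,
      (∏ i, (X : ℝ[X]) ^ (x i - y i).natAbs).coeff 1 = if Neighbors x y then 1 else 0 :=
    fun x y => by
      rw [Finset.prod_pow_eq_pow_sum, coeff_X_pow]
      congr 1
      zify
      simp [eq_comm]
  rw [← Fin.prod_const, Finset.prod_univ_sum]
  simp only [Finset.prod_univ_sum, finsetSum_coeff, hpow]
  rw [neighborCount, ← box, ← Finset.sum_coe_sort (box d n)]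
  exact Finset.sum_congr rfl fun x _ =>
    Finset.sum_coe_sort (box d n) fun y => if Neighbors (x : Fin d → ℤ) y then (1 : ℝ) else 0

theorem neighborCount_eq (d : ℕ) {n : ℕ} (hn : 0 < n) :
    neighborCount d n = 2 * d * n ^ (d - 1) * (n - 1) := by
  have hone : ∀ u v : ℤ, (if 1 = (u - v).natAbs then (1 : ℝ) else 0)
      = if |u - v| = 1 then 1 else 0 := fun u v => by
    congr 1
    grind
  have hzero : ∀ u v : ℤ, (0 = (u - v).natAbs) ↔ u = v := fun u v => by omega
  have hdiag : ∑ u ∈ Finset.Icc (1 : ℤ) n, ∑ v ∈ Finset.Icc (1 : ℤ) n,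
      (if u = v then (1 : ℝ) else 0) = n := by
    rw [Finset.sum_congr rfl fun u hu => (Finset.sum_ite_eq _ u _).trans (if_pos hu)]
    simp
  rw [neighborCount_eq_coeff, coeff_one_pow_eq]
  simp only [Polynomial.finsetSum_coeff, Polynomial.coeff_X_pow, hone, hzero, hdiag,
    sum_sum_abs_sub_eq_one hn]
  ring

end NeighborCount

section Blocks

theorem card_box (d n : ℕ) : (box d n).card = n ^ d := by
  simp [box]

theorem add_mul_mem_Icc {m n : ℕ} {b : ℤ} (hb : b ∈ Finset.Icc (1 : ℤ) n) (a : Fin m) :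
    b + n * a ∈ Finset.Icc (1 : ℤ) (m * n : ℕ) := by
  have ha : (a + 1 : ℤ) ≤ m := by exact_mod_cast a.isLt
  rw [Finset.mem_Icc] at hb ⊢
  push_cast
  constructor <;> nlinarith

theorem add_mul_sub_one_ediv {n : ℕ} {b : ℤ} (hb : b ∈ Finset.Icc (1 : ℤ) n) (a : ℤ) :
    (b + n * a - 1) / n = a := by
  rw [Finset.mem_Icc] at hb
  rw [add_sub_right_comm, Int.add_mul_ediv_left _ _ (by omega),
    Int.ediv_eq_zero_of_lt (by omega) (by omega), zero_add]

/-- The point of `V_{mn}` at position `b` in the translate of `V_n` by `n a`. -/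
def blockPoint {d m n : ℕ} (p : (Fin d → Fin m) × box d n) : box d (m * n) :=
  ⟨fun i => (p.2 : Fin d → ℤ) i + n * p.1 i, Fintype.mem_piFinset.2 fun i =>
    add_mul_mem_Icc (Fintype.mem_piFinset.1 p.2.2 i) (p.1 i)⟩

theorem blockPoint_injective {d m n : ℕ} :
    Function.Injective (blockPoint : (Fin d → Fin m) × box d n → box d (m * n)) := by
  rintro ⟨a, b⟩ ⟨a', b'⟩ h
  have hcoord : ∀ i, (b : Fin d → ℤ) i + n * a i = (b' : Fin d → ℤ) i + n * a' i :=
    congrFun (congrArg Subtype.val h)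
  have ha : a = a' := funext fun i => by
    have hdiv := congrArg (fun z : ℤ => (z - 1) / n) (hcoord i)
    simp only [add_mul_sub_one_ediv (Fintype.mem_piFinset.1 b.2 i),
      add_mul_sub_one_ediv (Fintype.mem_piFinset.1 b'.2 i)] at hdiv
    exact Fin.ext (Nat.cast_injective hdiv)
  subst ha
  exact Prod.ext rfl (Subtype.ext (funext fun i => add_right_cancel (hcoord i)))

/-- The decomposition of `V_{mn}` into `m^d` disjoint translates of `V_n`. -/
noncomputable def blockEquiv (d m n : ℕ) : (Fin d → Fin m) × box d n ≃ box d (m * n) :=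
  Equiv.ofBijective blockPoint <| (Fintype.bijective_iff_injective_and_card _).2
    ⟨blockPoint_injective, by simp [card_box, mul_pow]⟩

theorem neighbors_blockEquiv {d m n : ℕ} (a : Fin d → Fin m) (b b' : box d n) :
    Neighbors (blockEquiv d m n (a, b) : Fin d → ℤ) (blockEquiv d m n (a, b'))
      ↔ Neighbors (b : Fin d → ℤ) b' := by
  simp [Neighbors, blockEquiv, blockPoint]

theorem neighborCount_mul_sub_le (d : ℕ) {m n : ℕ} (hm : 0 < m) (hn : 0 < n) :
    neighborCount d (m * n) - m ^ d * neighborCount d n ≤ 2 * d * (m * n) ^ d / n := by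
  rw [neighborCount_eq d (Nat.mul_pos hm hn), neighborCount_eq d hn]
  rcases d with _ | d
  · simp
  · have hn' : (n : ℝ) ≠ 0 := Nat.cast_ne_zero.2 hn.ne'
    calc _ = 2 * ((d + 1 : ℕ) : ℝ) * (m * n) ^ d * (m - 1) := by
          rw [Nat.add_sub_cancel]
          push_cast
          ring
      _ ≤ 2 * ((d + 1 : ℕ) : ℝ) * (m * n) ^ d * m := by
          gcongr
          exact sub_le_self _ zero_le_one
      _ = _ := by
          field_simp
          ring

end Blocks

section FreeEnergyLimit

variable {d n : ℕ}

/-- The interaction `β ∑_{⟨xy⟩} σ_x σ_y`. -/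
noncomputable def isingInteraction (β : ℝ) (σ : Config d n) : ℝ :=
  β * ((1 / 2 : ℝ) * ∑ x : box d n, ∑ y : box d n,
    if Neighbors (x : Fin d → ℤ) y then spin σ x * spin σ y else 0)

theorem meanFreeEnergy_eq (d n : ℕ) (β h : ℝ) :
    meanFreeEnergy d n β h = RandomField.freeEnergy (isingInteraction (d := d) (n := n) β) h := by
  rw [RandomField.freeEnergy, Fintype.card_coe]
  exact integral_div _ _

theorem abs_isingInteraction_sub_sum_blocks_le (m : ℕ) (β : ℝ) (σ : Config d (m * n)) :
    |isingInteraction β σ - ∑ a, isingInteraction β fun b => σ (blockEquiv d m n (a, b))|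
      ≤ |β| / 2 * (neighborCount d (m * n) - m ^ d * neighborCount d n) := by
  have hspin : ∀ x y : box d (m * n),
      |if Neighbors (x : Fin d → ℤ) y then spin σ x * spin σ y else 0|
        ≤ if Neighbors (x : Fin d → ℤ) y then 1 else 0 := fun x y => by
    split_ifs
    · rw [abs_mul, spin, spin, RandomField.abs_unit_cast, RandomField.abs_unit_cast, one_mul]
    · exact abs_zero.le
  have hblocks := RandomField.abs_sum_sub_sum_blocks_le (blockEquiv d m n) hspin
  simp only [neighbors_blockEquiv] at hblocks
  calc _ = |β| / 2 * _ := by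
        simp only [isingInteraction, ← Finset.mul_sum, ← mul_sub, abs_mul]
        rw [abs_of_pos (one_half_pos (α := ℝ)), ← mul_assoc, mul_one_div]
    _ ≤ _ := by
        refine mul_le_mul_of_nonneg_left (hblocks.trans_eq ?_) (by positivity)
        simp [neighborCount]

theorem abs_meanFreeEnergy_mul_sub_le (d : ℕ) {m n : ℕ} (hm : 0 < m) (hn : 0 < n) (β h : ℝ) :
    |meanFreeEnergy d (m * n) β h - meanFreeEnergy d n β h| ≤ |β| * d / n := by
  have hm' : (0 : ℝ) < m := Nat.cast_pos.2 hm
  have hn' : (0 : ℝ) < n := Nat.cast_pos.2 hn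
  have hmean := RandomField.abs_meanLogPartition_sub_le
    (abs_isingInteraction_sub_sum_blocks_le (d := d) (n := n) m β) h
  rw [RandomField.meanLogPartition_blocks, Fintype.card_pi_const, Fintype.card_fin] at hmean
  simp only [meanFreeEnergy_eq, RandomField.freeEnergy, Fintype.card_coe, card_box]
  calc _ = |RandomField.meanLogPartition (isingInteraction (d := d) (n := m * n) β) h
          - (m ^ d : ℕ) * RandomField.meanLogPartition (isingInteraction (d := d) (n := n) β) h|
          / (m * n) ^ d := by
        rw [← abs_of_pos (pow_pos (mul_pos hm' hn') d), ← abs_div]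
        push_cast
        rw [mul_pow]
        congr 1
        field_simp
    _ ≤ |β| / 2 * (2 * d * (m * n) ^ d / n) / (m * n) ^ d := by
        gcongr
        exact hmean.trans (by gcongr; exact neighborCount_mul_sub_le d hm hn)
    _ = _ := by field_simp

theorem tendsto_freeEnergy_isingInteraction (d : ℕ) (β h : ℝ) :
    Tendsto (fun n => RandomField.freeEnergy (isingInteraction (d := d) (n := n) β) h) atTop
      (nhds (limitFreeEnergy d β h)) := by
  simp only [← meanFreeEnergy_eq]
  exact (RandomField.cauchySeq_of_abs_sub_mul_le fun _ _ hm hn =>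
    abs_meanFreeEnergy_mul_sub_le d hm hn β h).tendsto_limUnder

theorem differentiableAt_limitFreeEnergy {β h : ℝ} (hβ : 0 < β) (hh : 0 < h)
    (hA : (β, h) ∉ exceptionalSet d) : DifferentiableAt ℝ (limitFreeEnergy d β) h := by
  by_contra hnot
  exact hA ⟨hβ, hh, hnot⟩

theorem tendsto_card_box (hd : 1 ≤ d) :
    Tendsto (fun n => Fintype.card (box d n)) atTop atTop := by
  simp only [Fintype.card_coe, card_box]
  exact tendsto_pow_atTop (by omega)

theorem overlap_eq (σ τ : Config d n) : overlap σ τ = RandomField.overlap σ τ := by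
  rw [RandomField.overlap, Fintype.card_coe]
  rfl

theorem overlaps_eq {k : ℕ} (s : Fin (k + 1) → Config d n) :
    overlaps s = fun i j => RandomField.overlap (s i.castSucc) (s j.castSucc) :=
  funext₂ fun _ _ => overlap_eq _ _

theorem quenchedAvg_eq {m : ℕ} (β h : ℝ) (F : (Fin m → Config d n) → ℝ) :
    quenchedAvg β h F = RandomField.quenchedAvg (isingInteraction β) h F :=
  rfl

end FreeEnergyLimit

end RFIM

theorem lemma2p9_general {ι : Type*} {l : Filter ι} {V : ι → Type*} [∀ i, Fintype (V i)]
    [∀ i, DecidableEq (V i)] {H : ∀ i, (V i → ℤˣ) → ℝ} {P : ℝ → ℝ} {h : ℝ}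
    (hV : Filter.Tendsto (fun i => Fintype.card (V i)) l Filter.atTop)
    (hP : ∀ t, Filter.Tendsto (fun i => RandomField.freeEnergy (H i) t) l (nhds (P t)))
    (hdiff : DifferentiableAt ℝ P h) (hh : h ≠ 0) {k : ℕ} [NeZero k] {C : ℝ}
    {F : ∀ i, (Fin k → V i → ℤˣ) → ℝ} (hF : ∀ i s, |F i s| ≤ C) :
    Filter.Tendsto (fun i => RandomField.ghirlandaGuerraDefect (H i) h (F i)) l (nhds 0) := by
  have hhk : h * k ≠ 0 := mul_ne_zero hh (Nat.cast_ne_zero.2 (NeZero.ne k))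
  have hbound := (RandomField.tendsto_fieldDeviation hV hP hdiff.hasDerivAt).const_mul (2 * C)
  rw [mul_zero] at hbound
  have hscaled : Filter.Tendsto
      (fun i => h * k * RandomField.ghirlandaGuerraDefect (H i) h (F i)) l (nhds 0) := by
    refine squeeze_zero_norm' ?_ hbound
    filter_upwards [hV.eventually_gt_atTop 0] with i hi
    have := Fintype.card_pos_iff.1 hi
    exact RandomField.abs_mul_ghirlandaGuerraDefect_le (H i) h (hF i) _
  simpa only [inv_mul_cancel_left₀ hhk, mul_zero] using hscaled.const_mul (h * k)⁻¹

theorem lemma2p9 (d : ℕ) (hd : 1 ≤ d) (β h : ℝ) (hβ : 0 < β) (hh : 0 < h)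
    (hA : (β, h) ∉ RFIM.exceptionalSet d) (k : ℕ) (hk : 2 ≤ k)
    (f : (Fin k → Fin k → ℝ) → ℝ)
    (hf : ∀ R : Fin k → Fin k → ℝ,
      (∀ i j, R i j ∈ Set.Icc (-1 : ℝ) 1) → f R ∈ Set.Icc (-1 : ℝ) 1) :
    Filter.Tendsto
      (fun n : ℕ =>
        RFIM.quenchedAvg β h (fun s : Fin (k + 1) → RFIM.Config d n =>
            f (RFIM.overlaps s) * RFIM.overlap (s 0) (s (Fin.last k)))
          - (1 / (k : ℝ))
            * RFIM.quenchedAvg β h (fun s : Fin (k + 1) → RFIM.Config d n =>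
                f (RFIM.overlaps s))
            * RFIM.quenchedAvg β h (fun s : Fin (k + 1) → RFIM.Config d n =>
                RFIM.overlap (s 0) (s 1))
          - (1 / (k : ℝ)) * ∑ i ∈ Finset.Ioo (0 : Fin (k + 1)) (Fin.last k),
              RFIM.quenchedAvg β h (fun s : Fin (k + 1) → RFIM.Config d n =>
                f (RFIM.overlaps s) * RFIM.overlap (s 0) (s i)))
      Filter.atTop (nhds 0) := by
  have : NeZero k := ⟨by omega⟩
  have hbound : ∀ n (s : Fin k → RFIM.Config d n),
      |f fun i j => RandomField.overlap (s i) (s j)| ≤ 1 := fun n s =>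
    abs_le.2 (hf _ fun i j => abs_le.1 (RandomField.abs_overlap_le_one _ _))
  simpa only [RandomField.ghirlandaGuerraDefect, RFIM.quenchedAvg_eq, RFIM.overlaps_eq,
    RFIM.overlap_eq] using lemma2p9_general (RFIM.tendsto_card_box hd)
      (RFIM.tendsto_freeEnergy_isingInteraction d β)
      (RFIM.differentiableAt_limitFreeEnergy hβ hh hA) hh.ne' hbound
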